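/- There are absolute constants $C, D > 0$ such that the following holds. Let $(X,d)$ be a finite metric space with doubling constant $\lambda$, i.e. $\lambda$ is the least integer such that every ball of radius $2r$ ($r>0$) in $X$ can be covered by $\lambda$ balls of radius $r$, and let $\alpha \ge 2$ be a real number. Then $X$ has a tree cover with distortion $C\alpha = O(\alpha)$ and size $$k \le D\cdot \lambda^{1/\alpha}\,\log\alpha\,\log\lambda = O\!\left(\lambda^{1/\alpha}\log\alpha\log\lambda\right);$$ that is, there are $k$ finite trees $T_1,\dots,T_k$ with positive edge weights and with $X\subseteq V(T_i)$, such that, writing $d_{T_i}(x,y)$ for the length of the path from $x$ to $y$ in $T_i$, (1) $d_{T_i}(x,y)\ge d(x,y)$ for all $i$ and all $x,y\in X$, and (2) for all $x\ne y$ in $X$ there is an $i$ with $d_{T_i}(x,y)\le C\alpha\cdot d(x,y)$. Moreover, the trees can be chosen so that each $d_{T_i}$ restricted to $X$ is an ultrametric, and in fact a $2$-HST metric: there is a finite rooted tree whose leaves are exactly the points of $X$, with nonnegative node labels that are $0$ at the leaves and decrease by a factor of at least $2$ from every node to each of its children, such that $d_{T_i}(x,y)$ is the label of the least common ancestor of $x$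 and $y$ for all $x,y\in X$. -/

import Mathlib

universe u

/-- `IsDoublingWith X n`: every ball of radius `2 * r` in `X` is covered by at most `n` balls of
radius `r` (centred at points of `X`). -/
def IsDoublingWith (X : Type u) [MetricSpace X] (n : ℕ) : Prop :=
  ∀ (x : X) (r : ℝ), 0 < r → ∃ S : Finset X, S.card ≤ n ∧
    Metric.closedBall x (2 * r) ⊆ ⋃ y ∈ S, Metric.closedBall y r

/-- The doubling constant of `X`: the least `n` such that every ball of radius `2 * r` is covered
by `n` balls of radius `r`. -/
noncomputable def doublingConstant (X : Type u) [MetricSpace X] : ℕ :=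
  sInf {n : ℕ | IsDoublingWith X n}

/-- On a finite metric space the infimum in `doublingConstant` is attained. -/
theorem isDoublingWith_doublingConstant (X : Type u) [MetricSpace X] [Finite X] :
    IsDoublingWith X (doublingConstant X) := by
  have hne : {n : ℕ | IsDoublingWith X n}.Nonempty := by
    have := Fintype.ofFinite X
    refine ⟨(Finset.univ : Finset X).card, fun x r hr => ⟨Finset.univ, le_rfl, fun y _ => ?_⟩⟩
    simp only [Finset.mem_univ, Set.iUnion_true, Set.mem_iUnion]
    exact ⟨y, Metric.mem_closedBall_self hr.le⟩
  exact Nat.sInf_mem hne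

/-- A finite tree with positive edge weights whose vertex set contains the points of `X`
(through the injection `point`); it may have further (Steiner) vertices. -/
structure WeightedTree (X : Type u) where
  V : Type u
  finite : Finite V
  graph : SimpleGraph V
  isTree : graph.IsTree
  weight : Sym2 V → ℝ
  weight_pos : ∀ e ∈ graph.edgeSet, 0 < weight e
  point : X → V
  point_injective : Function.Injective point

namespace WeightedTree

variable {X : Type u}

/-- The unique path between two vertices of the tree. -/
noncomputable def path (T : WeightedTree X) (a b : T.V) : T.graph.Walk a b :=
  (T.isTree.existsUnique_path a b).choose

/-- The length in `T` of the path between two points of `X`: the sum of its edge weights. -/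
noncomputable def treeDist (T : WeightedTree X) (x y : X) : ℝ :=
  ((T.path (T.point x) (T.point y)).edges.map T.weight).sum

/-- Distances in the tree are at least the distances in `X`. -/
def Dominating [MetricSpace X] (T : WeightedTree X) : Prop :=
  ∀ x y : X, dist x y ≤ T.treeDist x y

/-- The tree metric, restricted to the points of `X`, satisfies the strong triangle inequality. -/
def IsUltrametric (T : WeightedTree X) : Prop :=
  ∀ x y z : X, T.treeDist x z ≤ max (T.treeDist x y) (T.treeDist y z)

end WeightedTree

/-- A tree cover of `X` with distortion `a` and size `k`: dominating trees `T 0, …, T (k - 1)`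
such that every pair of distinct points has distortion at most `a` in one of them. -/
def IsTreeCover {X : Type u} [MetricSpace X] (a : ℝ) (k : ℕ) (T : Fin k → WeightedTree X) : Prop :=
  (∀ i, (T i).Dominating) ∧
    ∀ x y : X, x ≠ y → ∃ i, (T i).treeDist x y ≤ a * dist x y

/-- A finite rooted tree (root `⊥`, parent `Order.pred`, least common ancestor `⊓`) whose leaves
are exactly the points of `X`, with nonnegative node labels that do not increase from a node to
its children and vanish on the leaves. -/
structure LabeledTree (X : Type u) where
  tree : RootedTree.{u}
  finite : Finite tree
  leaf : X → tree
  leaf_injective : Function.Injective leaf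
  range_leaf : Set.range leaf = {v : tree | IsMax v}
  label : tree → ℝ
  label_nonneg : ∀ v, 0 ≤ label v
  label_leaf : ∀ x, label (leaf x) = 0
  label_le_label_pred : ∀ v, label v ≤ label (Order.pred v)

namespace LabeledTree

variable {X : Type u}

/-- The label of the least common ancestor of two leaves. -/
def lcaDist (L : LabeledTree X) (x y : X) : ℝ :=
  L.label (L.leaf x ⊓ L.leaf y)

/-- Labels decrease by a factor of at least `μ` from each node to its children. -/
def IsSeparated (L : LabeledTree X) (μ : ℝ) : Prop :=
  ∀ v : L.tree, v ≠ ⊥ → μ * L.label v ≤ L.label (Order.pred v)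

end LabeledTree

/-- The tree metric of `T`, restricted to the points of `X`, is that of a `μ`-hierarchically
separated tree (`μ`-HST) with leaf set `X`. -/
def WeightedTree.IsHST {X : Type u} (T : WeightedTree X) (μ : ℝ) : Prop :=
  ∃ L : LabeledTree X, L.IsSeparated μ ∧ ∀ x y : X, T.treeDist x y = L.lcaDist x y

/-!
The proof is deterministic: partitions of bounded diameter are found by region growing, and a
growth argument in large balls replaces the usual random partitions and Lovász local lemma.

*One scale.* Region growing with an exponential density (`exists_radius`) carves the space into
parts of radius `Δ` such that, locally around every point, the weight of the points `x` whose balls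
`B(x, p)` are not cut is at least the full weight, discounted by `lam ^ (-O(p / Δ))`
(`IsDoublingWith.exists_carving`). Discounts at successive scales multiply
(`IsDoublingWith.exists_carvings`), and for a ball of radius `p` the exponents at the scales
`Δ ≥ a * p` form a geometric series, so that a fraction `q = lam ^ (-O(1 / a))` of the weight
survives the partitions at all of these scales simultaneously. This is what makes it possible to use
whole blocks of consecutive scales in one tree rather than one scale out of `log α`.

*Covering everything.* The elements to be covered are the points of nets at `L = O(log α)`
consecutive scales. Each phase builds one sequence of partitions and settles locally a fraction `q`
of the remaining elements. If an element is left after `m` phases, the number of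
remaining elements in balls around it grew by a factor `1 + q` with every step backwards, each step
enlarging the ball by a fixed radius; so there are `(1 + q) ^ m` net points in a ball of radius
`O(m)` times the largest scale (`exists_phases`). By packing there are at most
`lam ^ O(log (m * α))` of them, which is contradictory for some
`m = O(lam ^ (1 / α) * log α * log lam)` (`IsDoublingWith.exists_block`, `exists_parameters`).

*Joining the scales.* Blocks of `L` scales, separated by gaps of `L` scales, are joined from the
bottom up by making the partitions of each block respect the much smaller clusters of the blocks
below it; even and odd blocks give two families of `m` trees (`exists_tree_cover_of_blocks`). Within a
block the partitions need not be nested: a sequence of partitions with geometrically growing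
diameters defines a `2`-HST through the largest scale at which two points are separated
(`exists_hst_of_partitions`). Its nodes are the classes of a chain of partitions, and the
weighted tree on the same nodes has the labels of the least common ancestors as distances
(`PartitionChain.weightedTree_treeDist`).
-/

/-! ### Hierarchically separated trees from chains of partitions -/

/-- An increasing chain of partitions of `X`, from singletons at level `0` to one class at level
`top`. Level `n` is given by the map `rep n` sending a point to a representative of its class. -/
structure PartitionChain (X : Type u) where
  top : ℕ
  rep : ℕ → X → X
  rep_zero : ∀ x, rep 0 x = x
  rep_rep : ∀ {n m : ℕ}, n ≤ m → ∀ x, rep m (rep n x) = rep m x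
  rep_top : ∀ x y, rep top x = rep top y

namespace PartitionChain

variable {X : Type u} (P : PartitionChain X)

/-- The classes of all levels of the chain, a class being recorded by its level and its
representative. -/
def Node : Type u := {p : ℕ × X // p.1 ≤ P.top ∧ P.rep p.1 p.2 = p.2}

variable {P}

theorem rep_eq_of_le {n m : ℕ} (h : n ≤ m) {x y : X} (hxy : P.rep n x = P.rep n y) :
    P.rep m x = P.rep m y := by
  rw [← P.rep_rep h x, hxy, P.rep_rep h y]

namespace Node

/-- The level of a class. -/
def level (v : P.Node) : ℕ := v.1.1

/-- The representative of a class. -/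
def center (v : P.Node) : X := v.1.2

theorem level_le (v : P.Node) : v.level ≤ P.top := v.2.1

theorem rep_center (v : P.Node) : P.rep v.level v.center = v.center := v.2.2

@[ext]
theorem ext {v w : P.Node} (h₁ : v.level = w.level) (h₂ : v.center = w.center) : v = w :=
  Subtype.ext (Prod.ext h₁ h₂)

/-- The class of `x` at level `n`. -/
def mk' (n : ℕ) (hn : n ≤ P.top) (x : X) : P.Node :=
  ⟨(n, P.rep n x), hn, P.rep_rep le_rfl x⟩

/-- The class one level up that contains a given class; the top class is its own parent. -/
def parent (v : P.Node) : P.Node :=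
  mk' (min (v.level + 1) P.top) (min_le_right _ _) v.center

theorem level_parent (v : P.Node) : v.parent.level = min (v.level + 1) P.top := rfl

theorem center_parent (v : P.Node) :
    v.parent.center = P.rep (min (v.level + 1) P.top) v.center := rfl

/-- Coarser classes are smaller: the top class is the root. -/
instance : PartialOrder P.Node where
  le v w := w.level ≤ v.level ∧ P.rep v.level w.center = v.center
  le_refl v := ⟨le_rfl, v.rep_center⟩
  le_trans u v w h₁ h₂ := by
    refine ⟨h₂.1.trans h₁.1, ?_⟩
    rw [← P.rep_rep h₁.1, h₂.2, h₁.2]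
  le_antisymm v w h₁ h₂ := by
    have h : v.level = w.level := le_antisymm h₂.1 h₁.1
    refine ext h ?_
    rw [← h₁.2, h, w.rep_center]

theorem le_def {v w : P.Node} :
    v ≤ w ↔ w.level ≤ v.level ∧ P.rep v.level w.center = v.center := Iff.rfl

theorem exists_common (v w : P.Node) :
    ∃ k, v.level ≤ k ∧ w.level ≤ k ∧ P.rep k v.center = P.rep k w.center :=
  ⟨P.top, v.level_le, w.level_le, P.rep_top _ _⟩

open Classical in
/-- The level of the least common ancestor of two classes. -/
noncomputable def infLevel (v w : P.Node) : ℕ := Nat.find (exists_common v w)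

theorem infLevel_le (v w : P.Node) : infLevel v w ≤ P.top := by
  classical
  exact Nat.find_min' _ ⟨v.level_le, w.level_le, P.rep_top _ _⟩

theorem infLevel_spec (v w : P.Node) : v.level ≤ infLevel v w ∧ w.level ≤ infLevel v w ∧
    P.rep (infLevel v w) v.center = P.rep (infLevel v w) w.center := by
  classical
  exact Nat.find_spec (exists_common v w)

theorem infLevel_le_of {v w : P.Node} {k : ℕ} (h₁ : v.level ≤ k) (h₂ : w.level ≤ k)
    (h₃ : P.rep k v.center = P.rep k w.center) : infLevel v w ≤ k := by
  classical
  exact Nat.find_min' _ ⟨h₁, h₂, h₃⟩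

noncomputable instance : SemilatticeInf P.Node where
  inf v w := mk' (infLevel v w) (infLevel_le v w) v.center
  inf_le_left v w := ⟨(infLevel_spec v w).1, rfl⟩
  inf_le_right v w := ⟨(infLevel_spec v w).2.1, (infLevel_spec v w).2.2.symm⟩
  le_inf _ _ _ h₁ h₂ :=
    ⟨infLevel_le_of h₁.1 h₂.1 (h₁.2.trans h₂.2.symm), (P.rep_rep
      (infLevel_le_of h₁.1 h₂.1 (h₁.2.trans h₂.2.symm)) _).trans h₁.2⟩

noncomputable instance [Nonempty X] : OrderBot P.Node where
  bot := mk' P.top le_rfl (Classical.arbitrary X)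
  bot_le v := ⟨v.level_le, P.rep_top _ _⟩

theorem eq_of_level_eq_top {v w : P.Node} (hv : v.level = P.top) (hw : w.level = P.top) :
    v = w := by
  refine ext (hv.trans hw.symm) ?_
  rw [← v.rep_center, ← w.rep_center, hv, hw]
  exact P.rep_top _ _

theorem eq_bot_iff_level [Nonempty X] {v : P.Node} : v = ⊥ ↔ v.level = P.top :=
  ⟨fun h => h ▸ rfl, fun h => eq_of_level_eq_top h rfl⟩

theorem parent_le (v : P.Node) : v.parent ≤ v :=
  ⟨le_min (Nat.le_succ _) v.level_le, rfl⟩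

theorem parent_of_top {v : P.Node} (h : v.level = P.top) : v.parent = v :=
  eq_of_level_eq_top (by rw [level_parent, h]; simp) h

theorem level_parent_of_lt {v : P.Node} (h : v.level < P.top) :
    v.parent.level = v.level + 1 := by
  rw [level_parent]; omega

theorem le_parent_of_lt {v w : P.Node} (h : v < w) : v ≤ w.parent := by
  obtain ⟨h₁, h₂⟩ := le_def.1 h.le
  have h₃ : w.level ≠ v.level := by
    intro h₃
    refine h.ne (ext h₃.symm ?_)
    rw [← h₂, ← h₃, w.rep_center]
  have h₄ := v.level_le
  refine ⟨by rw [level_parent]; omega, ?_⟩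
  rw [center_parent, P.rep_rep (by omega), h₂]

noncomputable instance : PredOrder P.Node where
  pred := parent
  pred_le := parent_le
  min_of_le_pred {v} h w hw := by
    have h₁ : v.level = P.top := by
      by_contra hne
      have := level_parent_of_lt (lt_of_le_of_ne v.level_le hne)
      have := h.1
      omega
    have h₂ : w.level = P.top := le_antisymm w.level_le (h₁ ▸ hw.1)
    exact (eq_of_level_eq_top h₁ h₂).le
  le_pred_of_lt := le_parent_of_lt

instance : IsPredArchimedean P.Node where
  exists_pred_iterate_of_le {v w} h := by
    obtain ⟨k, hk⟩ := Nat.exists_eq_add_of_le h.1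
    induction k generalizing w with
    | zero =>
      refine ⟨0, (ext (by simpa using hk.symm) ?_ : w = v)⟩
      rw [← h.2, hk]; exact w.rep_center.symm
    | succ k ih =>
      have hw : w.level < P.top := by have := v.level_le; omega
      have hlt : v < w := lt_of_le_of_ne h (by rintro rfl; omega)
      obtain ⟨n, hn⟩ := ih (le_parent_of_lt hlt) (by rw [level_parent_of_lt hw]; omega)
      exact ⟨n + 1, hn⟩

theorem isMax_iff {v : P.Node} : IsMax v ↔ v.level = 0 := by
  constructor
  · intro h
    by_contra hne
    obtain ⟨n, hn⟩ := Nat.exists_eq_succ_of_ne_zero hne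
    have hle := v.level_le
    have h₁ : v ≤ mk' n (by omega) v.center :=
      ⟨by change n ≤ _; omega, (P.rep_rep (by omega) _).trans v.rep_center⟩
    have h₂ := (h h₁).1
    change v.level ≤ n at h₂
    omega
  · intro h w hw
    have h₁ : w.level = 0 := by have := hw.1; omega
    have : v = w := by
      refine ext (h.trans h₁.symm) ?_
      rw [← hw.2, h, P.rep_zero]
    exact this.ge

instance [Finite X] : Finite P.Node := by
  have : Finite (Fin (P.top + 1) × X) := inferInstance
  refine Finite.of_injective
    (fun v : P.Node => ((⟨v.level, Nat.lt_succ_of_le v.level_le⟩, v.center) : Fin (P.top + 1) × X))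
    fun v w h => ?_
  simp only [Prod.mk.injEq, Fin.mk.injEq] at h
  exact ext h.1 h.2

/-- The singleton class of a point. -/
def leaf (x : X) : P.Node := mk' 0 (Nat.zero_le _) x

theorem level_leaf (x : X) : (leaf x : P.Node).level = 0 := rfl

theorem center_leaf (x : X) : (leaf x : P.Node).center = x := P.rep_zero x

theorem leaf_injective : Function.Injective (leaf : X → P.Node) := fun x y h => by
  rw [← center_leaf (P := P) x, h, center_leaf]

/-- The graph in which each class is joined to its parent. -/
def graph (P : PartitionChain X) : SimpleGraph P.Node := SimpleGraph.fromRel fun v w => v.parent = w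

theorem graph_adj {v w : P.Node} :
    (graph P).Adj v w ↔ v ≠ w ∧ (v.parent = w ∨ w.parent = v) := SimpleGraph.fromRel_adj _ _ _

theorem adj_parent {v : P.Node} (h : v.level < P.top) : (graph P).Adj v v.parent := by
  refine graph_adj.2 ⟨fun he => ?_, Or.inl rfl⟩
  have := level_parent_of_lt h
  rw [← he] at this
  omega

theorem level_lt_of_parent_ne {v : P.Node} (h : v ≠ v.parent) : v.level < P.top :=
  lt_of_le_of_ne v.level_le fun he => h (parent_of_top he).symm

theorem graph_isTree [Finite X] [Nonempty X] : (graph P).IsTree := by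
  have hreach : ∀ k, ∀ v : P.Node, v.level + k = P.top → (graph P).Reachable v ⊥ := by
    intro k
    induction k with
    | zero => exact fun v hv => (eq_bot_iff_level.2 (by omega) : v = ⊥) ▸ .rfl
    | succ k ih =>
      intro v hv
      have hlt : v.level < P.top := by omega
      exact (adj_parent hlt).reachable.trans (ih _ (by rw [level_parent_of_lt hlt]; omega))
  have hconn : (graph P).Connected := by
    have : Nonempty P.Node := ⟨⊥⟩
    refine ⟨fun v w => ?_⟩
    exact (hreach (P.top - v.level) v (by have := v.level_le; omega)).trans
      (hreach (P.top - w.level) w (by have := w.level_le; omega)).symm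
  -- Every edge joins some non-root node to its parent, so there are few enough edges.
  refine SimpleGraph.isTree_iff_connected_and_card.2 ⟨hconn,
    le_antisymm ?_ hconn.card_vert_le_card_edgeSet_add_one⟩
  have hsub : (graph P).edgeSet ⊆ (fun v : P.Node => s(v, v.parent)) '' {v | v ≠ ⊥} := by
    intro e
    induction e with
    | _ v w =>
      intro h
      obtain ⟨hne, h | h⟩ : v ≠ w ∧ (v.parent = w ∨ w.parent = v) := graph_adj.1 h
      · exact ⟨v, fun hv => hne (h ▸ (parent_of_top (eq_bot_iff_level.1 hv)).symm), h ▸ rfl⟩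
      · exact ⟨w, fun hw => hne (h ▸ parent_of_top (eq_bot_iff_level.1 hw)), h ▸ Sym2.eq_swap⟩
  have h₁ : Nat.card (graph P).edgeSet ≤ ({v : P.Node | v ≠ ⊥} : Set P.Node).ncard := by
    rw [Nat.card_coe_set_eq]
    exact (Set.ncard_le_ncard hsub (Set.toFinite _)).trans (Set.ncard_image_le (Set.toFinite _))
  have h₂ : ({v : P.Node | v ≠ ⊥} : Set P.Node).ncard + 1 = Nat.card P.Node := by
    have := Set.ncard_add_ncard_compl ({(⊥ : P.Node)} : Set P.Node)
    rw [Set.ncard_singleton] at this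
    rw [← this, add_comm]; rfl
  omega

end Node

/-- The first level at which two points lie in the same class. -/
noncomputable def joinLevel (P : PartitionChain X) (x y : X) : ℕ :=
  Node.infLevel (Node.leaf x : P.Node) (Node.leaf y)

theorem joinLevel_le_top (x y : X) : P.joinLevel x y ≤ P.top := Node.infLevel_le _ _

theorem rep_joinLevel (x y : X) : P.rep (P.joinLevel x y) x = P.rep (P.joinLevel x y) y := by
  have h := (Node.infLevel_spec (Node.leaf x : P.Node) (Node.leaf y)).2.2
  rw [Node.center_leaf, Node.center_leaf] at h
  exact h

theorem joinLevel_le_iff {x y : X} {k : ℕ} : P.joinLevel x y ≤ k ↔ P.rep k x = P.rep k y :=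
  ⟨fun h => rep_eq_of_le h (rep_joinLevel x y), fun h =>
    Node.infLevel_le_of (Nat.zero_le _) (Nat.zero_le _) (by simpa only [Node.center_leaf] using h)⟩

theorem joinLevel_le_max (x y z : X) :
    P.joinLevel x z ≤ max (P.joinLevel x y) (P.joinLevel y z) :=
  joinLevel_le_iff.2 ((joinLevel_le_iff.1 (le_max_left _ _)).trans
    (joinLevel_le_iff.1 (le_max_right _ _)))

section Tree

variable {σ : ℕ → ℝ}

theorem strictMono_of_two_mul_le (h₀ : σ 0 = 0) (h₁ : 0 < σ 1)
    (h : ∀ n, 2 * σ n ≤ σ (n + 1)) : StrictMono σ := by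
  have hpos : ∀ n, 0 < σ (n + 1) := by
    intro n
    induction n with
    | zero => exact h₁
    | succ n ih => linarith [h (n + 1)]
  refine strictMono_nat_of_lt_succ fun n => ?_
  cases n with
  | zero => rw [h₀]; exact h₁
  | succ n => linarith [h (n + 1), hpos n]

/-- The labelled tree of classes, a class of level `n` having label `σ n`. -/
noncomputable def labeledTree [Finite X] [Nonempty X] (P : PartitionChain X) (h₀ : σ 0 = 0)
    (hσ : Monotone σ) : LabeledTree X where
  tree := { α := P.Node }
  finite := inferInstanceAs (Finite P.Node)
  leaf := Node.leaf
  leaf_injective := Node.leaf_injective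
  range_leaf := by
    ext v
    constructor
    · rintro ⟨x, rfl⟩
      exact Node.isMax_iff.2 rfl
    · intro h
      have hv : Node.level v = 0 := Node.isMax_iff.1 h
      exact ⟨Node.center v, Node.ext hv.symm (Node.center_leaf _)⟩
  label v := σ (Node.level v)
  label_nonneg v := h₀ ▸ hσ (Nat.zero_le _)
  label_leaf _ := h₀
  label_le_label_pred v := hσ (Node.parent_le v).1

theorem labeledTree_isSeparated [Finite X] [Nonempty X] (h₀ : σ 0 = 0) (hσ : Monotone σ)
    (h : ∀ n, 2 * σ n ≤ σ (n + 1)) : (P.labeledTree h₀ hσ).IsSeparated 2 := by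
  intro v hv
  have hlt : Node.level v < P.top :=
    lt_of_le_of_ne (Node.level_le v) fun he => hv (Node.eq_bot_iff_level.2 he)
  have h₁ : Node.level (Node.parent v) = Node.level v + 1 := Node.level_parent_of_lt hlt
  change 2 * σ (Node.level v) ≤ σ (Node.level (Node.parent v))
  rw [h₁]
  exact h _

theorem labeledTree_lcaDist [Finite X] [Nonempty X] (h₀ : σ 0 = 0) (hσ : Monotone σ) (x y : X) :
    (P.labeledTree h₀ hσ).lcaDist x y = σ (P.joinLevel x y) := rfl

/-- The weight of the edge joining two classes: half the difference of their labels. -/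
noncomputable def Node.edgeWeight (P : PartitionChain X) (σ : ℕ → ℝ) : Sym2 P.Node → ℝ :=
  Sym2.lift ⟨fun v w => |σ v.level - σ w.level| / 2, fun v w => by
    simp only [abs_sub_comm (σ v.level)]⟩

theorem Node.edgeWeight_mk (v w : P.Node) :
    Node.edgeWeight P σ s(v, w) = |σ v.level - σ w.level| / 2 := rfl

/-- The total weight of the edges of a walk. -/
noncomputable def walkWeight (σ : ℕ → ℝ) {v w : P.Node} (p : (Node.graph P).Walk v w) : ℝ :=
  (p.edges.map (Node.edgeWeight P σ)).sum

/-- Climbing from a leaf to its class of level `n` costs half the label of that class. -/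
theorem exists_walk_up (hσ : StrictMono σ) (x : X) (n : ℕ) (hn : n ≤ P.top) :
    ∃ p : (Node.graph P).Walk (Node.leaf x) (Node.mk' n hn x),
      walkWeight σ p = (σ n - σ 0) / 2 := by
  induction n with
  | zero => exact ⟨.nil, by rw [sub_self, zero_div]; rfl⟩
  | succ n ih =>
    obtain ⟨p, hp⟩ := ih (by omega)
    have hlt : (Node.mk' n (by omega) x : P.Node).level < P.top := by
      change n < P.top; omega
    have hpar : (Node.mk' n (by omega) x : P.Node).parent = Node.mk' (n + 1) hn x := by
      refine Node.ext (Node.level_parent_of_lt hlt) ?_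
      change P.rep (min (n + 1) P.top) (P.rep n x) = P.rep (n + 1) x
      rw [min_eq_left hn, P.rep_rep (Nat.le_succ n)]
    have hadj := Node.adj_parent hlt
    rw [hpar] at hadj
    refine ⟨p.concat hadj, ?_⟩
    have hlev : σ n ≤ σ (n + 1) := (hσ (Nat.lt_succ_self n)).le
    have hw : Node.edgeWeight P σ s(Node.mk' n (by omega) x, Node.mk' (n + 1) hn x)
        = (σ (n + 1) - σ n) / 2 := by
      rw [Node.edgeWeight_mk]
      change |σ n - σ (n + 1)| / 2 = _
      rw [abs_sub_comm, abs_of_nonneg (by linarith)]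
    unfold walkWeight at hp ⊢
    rw [SimpleGraph.Walk.edges_concat, List.concat_eq_append, List.map_append, List.sum_append, hp]
    simp only [List.map_cons, List.map_nil, List.sum_cons, List.sum_nil]
    rw [hw]; ring

/-- The distance in the tree from the leaf `x` to a node, in closed form. -/
noncomputable def potential (P : PartitionChain X) (σ : ℕ → ℝ) (x : X) (v : P.Node) : ℝ :=
  σ (Node.infLevel (Node.leaf x) v) - σ v.level / 2

theorem potential_parent_le (h₀ : Monotone σ) (x : X) (v : P.Node) (hv : v.level < P.top) :
    |potential P σ x v.parent - potential P σ x v| ≤ |σ v.level - σ v.parent.level| / 2 := by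
  have hl := Node.level_parent_of_lt hv
  have hs : ∀ k, v.parent.level ≤ k → P.rep k v.parent.center = P.rep k v.center := fun k hk => by
    rw [Node.center_parent, P.rep_rep (by rw [← Node.level_parent]; exact hk)]
  have hmono : σ v.level ≤ σ v.parent.level := h₀ (by omega)
  obtain ⟨-, h₁, h₂⟩ := Node.infLevel_spec (Node.leaf x) v
  obtain ⟨-, h₃, h₄⟩ := Node.infLevel_spec (Node.leaf x) v.parent
  rw [hs _ h₃] at h₄
  have hle : Node.infLevel (Node.leaf x) v ≤ Node.infLevel (Node.leaf x) v.parent :=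
    Node.infLevel_le_of (Nat.zero_le _) (by omega) h₄
  rw [abs_sub_comm (σ v.level), abs_of_nonneg (sub_nonneg.2 hmono)]
  unfold potential
  rcases Nat.lt_or_ge v.level (Node.infLevel (Node.leaf x) v) with hlt | hge
  · have hk : v.parent.level ≤ Node.infLevel (Node.leaf x) v := by omega
    have : Node.infLevel (Node.leaf x) v.parent = Node.infLevel (Node.leaf x) v :=
      le_antisymm (Node.infLevel_le_of (Nat.zero_le _) hk (by rw [hs _ hk]; exact h₂)) hle
    rw [this, abs_le]
    constructor <;> linarith
  · have he : Node.infLevel (Node.leaf x) v = v.level := le_antisymm hge h₁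
    have : Node.infLevel (Node.leaf x) v.parent = v.parent.level := by
      refine le_antisymm (Node.infLevel_le_of (Nat.zero_le _) le_rfl ?_) h₃
      rw [hs _ le_rfl]
      exact rep_eq_of_le (by omega) h₂
    rw [this, he, abs_le]
    constructor <;> linarith

theorem potential_sub_le_walkWeight (hσ : StrictMono σ) (x : X) {v w : P.Node}
    (p : (Node.graph P).Walk v w) :
    potential P σ x w - potential P σ x v ≤ walkWeight σ p := by
  induction p with
  | nil => simp [walkWeight]
  | @cons a b c h p ih =>
    have hstep : potential P σ x b - potential P σ x a ≤ |σ a.level - σ b.level| / 2 := by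
      obtain ⟨hne, h | h⟩ : a ≠ b ∧ (a.parent = b ∨ b.parent = a) := Node.graph_adj.1 h
      · have := potential_parent_le hσ.monotone x a (Node.level_lt_of_parent_ne (h ▸ hne))
        rw [h] at this
        exact (le_abs_self _).trans this
      · have := potential_parent_le hσ.monotone x b (Node.level_lt_of_parent_ne (h ▸ hne.symm))
        rw [h, abs_sub_comm, abs_sub_comm (σ _)] at this
        exact (le_abs_self _).trans this
    have : walkWeight σ (SimpleGraph.Walk.cons h p)
        = |σ a.level - σ b.level| / 2 + walkWeight σ p := by
      simp only [walkWeight, SimpleGraph.Walk.edges_cons, List.map_cons, List.sum_cons]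
      rw [Node.edgeWeight_mk]
    linarith

/-- The tree of classes as a weighted tree. The edge weights are half the differences of the
labels, so that the distance of two leaves is the label of their least common ancestor. -/
noncomputable def weightedTree [Finite X] [Nonempty X] (P : PartitionChain X)
    (hσ : StrictMono σ) : WeightedTree X where
  V := P.Node
  finite := inferInstance
  graph := Node.graph P
  isTree := Node.graph_isTree
  weight := Node.edgeWeight P σ
  weight_pos e := by
    induction e with
    | _ v w =>
      intro h
      have hne : v.level ≠ w.level := by
        obtain ⟨hne, h | h⟩ : v ≠ w ∧ (v.parent = w ∨ w.parent = v) := Node.graph_adj.1 h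
        · rw [← h, Node.level_parent_of_lt (Node.level_lt_of_parent_ne (h ▸ hne))]; omega
        · rw [← h, Node.level_parent_of_lt (Node.level_lt_of_parent_ne (h ▸ hne.symm))]; omega
      have : 0 < |σ v.level - σ w.level| := abs_pos.2 (sub_ne_zero.2 (hσ.injective.ne hne))
      exact half_pos this
  point := Node.leaf
  point_injective := Node.leaf_injective

theorem treeDist_le_walkWeight [Finite X] [Nonempty X] (hσ : StrictMono σ) {x y : X}
    (p : (Node.graph P).Walk (Node.leaf x) (Node.leaf y)) :
    (P.weightedTree hσ).treeDist x y ≤ walkWeight σ p := by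
  classical
  have h : (P.weightedTree hσ).path (Node.leaf x) (Node.leaf y) = p.bypass :=
    ((P.weightedTree hσ).isTree.existsUnique_path _ _).unique
      (((P.weightedTree hσ).isTree.existsUnique_path _ _).choose_spec.1) p.bypass_isPath
  have hsub := (p.edges_bypass_sublist_edges).map (Node.edgeWeight P σ)
  have : (P.weightedTree hσ).treeDist x y
      = (p.bypass.edges.map (Node.edgeWeight P σ)).sum := by
    rw [← h]; rfl
  rw [this]
  refine hsub.sum_le_sum fun a ha => ?_
  obtain ⟨e, -, rfl⟩ := List.mem_map.1 ha
  induction e with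
  | _ v w => rw [Node.edgeWeight_mk]; positivity

theorem weightedTree_treeDist [Finite X] [Nonempty X] (hσ : StrictMono σ) (h₀ : σ 0 = 0) (x y : X) :
    (P.weightedTree hσ).treeDist x y = σ (P.joinLevel x y) := by
  apply le_antisymm
  · obtain ⟨p, hp⟩ := exists_walk_up hσ x (P.joinLevel x y) (joinLevel_le_top x y)
    obtain ⟨q, hq⟩ := exists_walk_up hσ y (P.joinLevel x y) (joinLevel_le_top x y)
    have he : (Node.mk' (P.joinLevel x y) (joinLevel_le_top x y) y : P.Node)
        = Node.mk' (P.joinLevel x y) (joinLevel_le_top x y) x :=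
      Node.ext rfl (rep_joinLevel x y).symm
    refine (treeDist_le_walkWeight hσ (p.append (q.copy rfl he).reverse)).trans (le_of_eq ?_)
    unfold walkWeight at hp hq ⊢
    rw [SimpleGraph.Walk.edges_append, List.map_append, List.sum_append,
      SimpleGraph.Walk.edges_reverse, List.map_reverse, List.sum_reverse,
      SimpleGraph.Walk.edges_copy, hp, hq, h₀]
    ring
  · have h := potential_sub_le_walkWeight hσ x
      ((P.weightedTree hσ).path (Node.leaf x) (Node.leaf y))
    have h₁ : potential P σ x (Node.leaf y) = σ (P.joinLevel x y) := by
      simp [potential, joinLevel, Node.level_leaf, h₀]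
    have h₂ : potential P σ x (Node.leaf x) = 0 := by
      have : P.joinLevel x x = 0 := Nat.le_zero.1 (joinLevel_le_iff.2 rfl)
      change σ (P.joinLevel x x) - _ = 0
      simp [this, Node.level_leaf, h₀]
    rw [h₁, h₂, sub_zero] at h
    exact h

end Tree

end PartitionChain

/-- A sequence of partitions of `X` (the fibres of `h n`, `n < N`), with diameter bounds `s n`
that at least double, yields a `2`-HST: two points are put at distance `s n` if they lie in
different parts of partition `n - 1` but in the same part of all later ones. No compatibility
between the partitions is needed. -/
theorem exists_hst_of_partitions {X : Type u} [MetricSpace X] [Finite X] [Nonempty X]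
    {β : Type*} (h : ℕ → X → β) (N : ℕ) (s : ℕ → ℝ) (hs₀ : 0 < s 0)
    (hs : ∀ n, 2 * s n ≤ s (n + 1))
    (hdiam : ∀ n < N, ∀ x y, h n x = h n y → dist x y ≤ s n)
    (htop : ∀ x y : X, dist x y ≤ s N) :
    ∃ T : WeightedTree X, T.Dominating ∧ T.IsUltrametric ∧ T.IsHST 2 ∧
      ∀ n ≤ N, ∀ x y, (∀ k, n ≤ k → k < N → h k x = h k y) → T.treeDist x y ≤ s n := by
  classical
  -- At level `m + 1` two points are equivalent if no partition from the `m`-th on separates them.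
  let S : ℕ → Setoid X := fun n => Nat.casesOn n ⊥ fun m =>
    { r := fun x y => ∀ k, m ≤ k → k < N → h k x = h k y
      iseqv := ⟨fun _ _ _ _ => rfl, fun H k h₁ h₂ => (H k h₁ h₂).symm,
        fun H H' k h₁ h₂ => (H k h₁ h₂).trans (H' k h₁ h₂)⟩ }
  have hS₀ : ∀ x y, (S 0).r x y ↔ x = y := fun x y => Iff.rfl
  have hS₁ : ∀ m x y, (S (m + 1)).r x y ↔ ∀ k, m ≤ k → k < N → h k x = h k y :=
    fun m x y => Iff.rfl
  have hmono : ∀ {n m : ℕ}, n ≤ m → ∀ x y, (S n).r x y → (S m).r x y := by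
    intro n m hnm x y hxy
    cases m with
    | zero => obtain rfl : n = 0 := by omega
              exact hxy
    | succ m =>
      cases n with
      | zero => rw [hS₀] at hxy; subst hxy; exact (S (m + 1)).refl' x
      | succ n => exact fun k hk => hxy k (by omega)
  let c : ℕ → X → X := fun n x => (Quotient.mk (S n) x).out
  have hc : ∀ n x, (S n).r (c n x) x := fun n x => Quotient.exact (Quotient.out_eq _)
  have hceq : ∀ n x y, c n x = c n y ↔ (S n).r x y := fun n x y =>
    ⟨fun he => (S n).trans ((S n).symm (hc n x)) (he ▸ hc n y), fun he => by
      change (Quotient.mk (S n) x).out = (Quotient.mk (S n) y).out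
      rw [Quotient.sound he]⟩
  let P : PartitionChain X :=
    { top := N + 1
      rep := c
      rep_zero := fun x => (hS₀ _ _).1 (hc 0 x)
      rep_rep := fun {n m} hnm x => (hceq _ _ _).2 (hmono hnm _ _ (hc n x))
      rep_top := fun x y => (hceq (N + 1) x y).2 ((hS₁ N x y).2 fun k h₁ h₂ => by omega) }
  let σ : ℕ → ℝ := fun n => Nat.casesOn n 0 s
  have hσ : StrictMono σ := PartitionChain.strictMono_of_two_mul_le rfl hs₀ fun n => by
    cases n with
    | zero => change 2 * 0 ≤ s 0; linarith
    | succ n => exact hs n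
  have hdist : ∀ x y, (P.weightedTree hσ).treeDist x y = σ (P.joinLevel x y) :=
    PartitionChain.weightedTree_treeDist hσ rfl
  refine ⟨P.weightedTree hσ, fun x y => ?_, fun x y z => ?_, ?_, fun n hn x y hxy => ?_⟩
  · rw [hdist]
    have h₁ : (S (P.joinLevel x y)).r x y :=
      (hceq _ _ _).1 (PartitionChain.rep_joinLevel (P := P) x y)
    have h₂ : P.joinLevel x y ≤ N + 1 := PartitionChain.joinLevel_le_top x y
    cases hj : P.joinLevel x y with
    | zero =>
      rw [hj, hS₀] at h₁
      simp [h₁, σ]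
    | succ n =>
      rw [hj, hS₁] at h₁
      change dist x y ≤ s n
      rcases Nat.lt_or_ge n N with hlt | hge
      · exact hdiam n hlt x y (h₁ n le_rfl hlt)
      · obtain rfl : n = N := by omega
        exact htop x y
  · simp only [hdist]
    rw [← hσ.monotone.map_max]
    exact hσ.monotone (PartitionChain.joinLevel_le_max x y z)
  · refine ⟨P.labeledTree rfl hσ.monotone, PartitionChain.labeledTree_isSeparated rfl hσ.monotone
      fun n => ?_, fun x y => ?_⟩
    · cases n with
      | zero => change 2 * 0 ≤ s 0; linarith
      | succ n => exact hs n
    · rw [hdist, PartitionChain.labeledTree_lcaDist]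
  · rw [hdist]
    exact hσ.monotone ((PartitionChain.joinLevel_le_iff (P := P) (k := n + 1)).2
      ((hceq (n + 1) x y).2 ((hS₁ n x y).2 hxy)))

/-! ### Doubling spaces -/

section Doubling

variable {X : Type u} [MetricSpace X] {n : ℕ}

theorem IsDoublingWith.exists_cover (h : IsDoublingWith X n) (k : ℕ) (x : X) {r : ℝ}
    (hr : 0 < r) : ∃ S : Finset X, S.card ≤ n ^ k ∧
      Metric.closedBall x (2 ^ k * r) ⊆ ⋃ y ∈ S, Metric.closedBall y r := by
  classical
  induction k generalizing r with
  | zero => exact ⟨{x}, by simp, by simp⟩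
  | succ k ih =>
    obtain ⟨S, hS, hcov⟩ := ih (r := 2 * r) (by positivity)
    choose T hT hTcov using fun y => h y r hr
    refine ⟨S.biUnion T, ?_, fun z hz => ?_⟩
    · calc (S.biUnion T).card ≤ S.card * n := Finset.card_biUnion_le_card_mul _ _ _ fun y _ => hT y
        _ ≤ n ^ k * n := Nat.mul_le_mul_right _ hS
        _ = n ^ (k + 1) := (pow_succ _ _).symm
    · rw [pow_succ, mul_assoc] at hz
      obtain ⟨y, hy, hzy⟩ := Set.mem_iUnion₂.1 (hcov hz)
      obtain ⟨t, ht, hzt⟩ := Set.mem_iUnion₂.1 (hTcov y hzy)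
      exact Set.mem_iUnion₂.2 ⟨t, Finset.mem_biUnion.2 ⟨y, hy, ht⟩, hzt⟩

theorem IsDoublingWith.card_le_of_separated (h : IsDoublingWith X n) (k : ℕ) (x : X) {r : ℝ}
    (hr : 0 < r) (N : Finset X) (hsep : ∀ y ∈ N, ∀ z ∈ N, y ≠ z → 2 * r < dist y z)
    (hN : ∀ y ∈ N, dist y x ≤ 2 ^ k * r) : N.card ≤ n ^ k := by
  obtain ⟨S, hS, hcov⟩ := h.exists_cover k x hr
  refine le_trans (Finset.card_le_card_of_forall_subsingleton (fun y s => dist y s ≤ r)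
    (fun y hy => ?_) fun s _ y hy z hz => ?_) hS
  · obtain ⟨s, hs, hys⟩ := Set.mem_iUnion₂.1 (hcov (Metric.mem_closedBall.2 (hN y hy)))
    exact ⟨s, hs, hys⟩
  · by_contra hne
    have h₁ := hsep y hy.1 z hz.1 hne
    have h₂ := dist_triangle_right y z s
    linarith [hy.2, hz.2]

theorem IsDoublingWith.two_le (h : IsDoublingWith X n) {x y : X} (hxy : x ≠ y) : 2 ≤ n := by
  classical
  have hd : 0 < dist x y := dist_pos.2 hxy
  have h₁ := h.card_le_of_separated 2 x (r := dist x y / 4) (by positivity) {x, y}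
    (fun a ha b hb hab => by
      simp only [Finset.mem_insert, Finset.mem_singleton] at ha hb
      rcases ha with rfl | rfl <;> rcases hb with rfl | rfl
      · exact absurd rfl hab
      · linarith
      · rw [dist_comm] at hd ⊢; linarith
      · exact absurd rfl hab)
    (fun a ha => by
      simp only [Finset.mem_insert, Finset.mem_singleton] at ha
      rcases ha with rfl | rfl
      · rw [dist_self]; positivity
      · rw [dist_comm]; linarith)
  rw [Finset.card_pair hxy] at h₁
  by_contra hn
  have : n ^ 2 ≤ 1 ^ 2 := Nat.pow_le_pow_left (by omega) 2
  omega

/-- A maximal separated set. -/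
theorem exists_net [Finite X] {r : ℝ} (hr : 0 ≤ r) : ∃ N : Finset X,
    (∀ y ∈ N, ∀ z ∈ N, y ≠ z → r < dist y z) ∧ ∀ x, ∃ y ∈ N, dist x y ≤ r := by
  classical
  have := Fintype.ofFinite X
  obtain ⟨N, hN⟩ := Set.Finite.exists_maximal (Set.toFinite
    {N : Finset X | ∀ y ∈ N, ∀ z ∈ N, y ≠ z → r < dist y z}) ⟨∅, by simp⟩
  refine ⟨N, hN.1, fun x => ?_⟩
  by_contra! hx
  have hmem : insert x N ∈ {N : Finset X | ∀ y ∈ N, ∀ z ∈ N, y ≠ z → r < dist y z} := by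
    intro y hy z hz hyz
    rcases Finset.mem_insert.1 hy with hy' | hy' <;> rcases Finset.mem_insert.1 hz with hz' | hz'
    · exact absurd (hy'.trans hz'.symm) hyz
    · exact hy' ▸ hx z hz'
    · rw [dist_comm]; exact hz' ▸ hx y hy'
    · exact hN.1 y hy' z hz' hyz
  have hxN : x ∈ N := hN.2 hmem (Finset.subset_insert x N) (Finset.mem_insert_self x N)
  have := hx x hxN
  rw [dist_self] at this
  linarith

end Doubling

/-! ### Choosing the radius of a cluster -/

section Radius

open MeasureTheory intervalIntegral

theorem intervalIntegrable_tail (b c s t : ℝ) : IntervalIntegrable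
    (fun ρ => if c ≤ ρ then b * Real.exp (-(b * ρ)) else 0) volume s t := by
  have h : IntervalIntegrable (fun ρ => b * Real.exp (-(b * ρ))) volume s t :=
    (by fun_prop : Continuous fun ρ => b * Real.exp (-(b * ρ))).intervalIntegrable _ _
  have hs : MeasurableSet (Set.Ici c) := measurableSet_Ici
  exact ⟨h.1.indicator hs, h.2.indicator hs⟩

/-- The mass that the exponential density of rate `b` gives to `[s, t] ∩ [c, ∞)`. -/
theorem integral_tail (b c : ℝ) {s t : ℝ} (hst : s ≤ t) :
    ∫ ρ in s..t, (if c ≤ ρ then b * Real.exp (-(b * ρ)) else 0)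
      = Real.exp (-(b * max s c)) - Real.exp (-(b * max t c)) := by
  have h := integral_eq_sub_of_hasDeriv_right_of_le hst
    (f := fun ρ => -Real.exp (-(b * max ρ c)))
    (f' := fun ρ => if c ≤ ρ then b * Real.exp (-(b * ρ)) else 0)
    (by fun_prop) (fun ρ _ => ?_) (intervalIntegrable_tail b c s t)
  · rw [h]; ring
  · by_cases hc : c ≤ ρ
    · have h₁ : HasDerivAt (fun ρ => -Real.exp (-(b * ρ))) (b * Real.exp (-(b * ρ))) ρ := 
        ((((hasDerivAt_id' ρ).const_mul b).neg).exp).neg.congr_deriv (by simp [mul_comm])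
      simp only [hc, if_true]
      refine h₁.hasDerivWithinAt.congr (fun y hy => ?_) ?_
      · rw [max_eq_left (hc.trans (le_of_lt hy))]
      · rw [max_eq_left hc]
    · simp only [hc, if_false]
      refine ((hasDerivAt_const ρ (-Real.exp (-(b * c)))).congr_of_eventuallyEq ?_).hasDerivWithinAt
      filter_upwards [Iio_mem_nhds (not_le.1 hc)] with y hy
      rw [max_eq_right (le_of_lt hy)]

/-- What an element at distance `d` with pad `p` contributes to the average, over a random radius,
of the discounted mass touched minus the mass contained. -/
theorem tail_sub_tail_le {b d p Δ : ℝ} (hb : 0 ≤ b) (hp : 0 ≤ p) (hp' : p ≤ Δ / 4) :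
    Real.exp (-(2 * b * p)) *
        (Real.exp (-(b * max (Δ / 2) (d - p))) - Real.exp (-(b * max Δ (d - p)))) -
      (Real.exp (-(b * max (Δ / 2) (d + p))) - Real.exp (-(b * max Δ (d + p)))) ≤
    (1 - Real.exp (-(2 * b * p))) * ((if d ≤ 2 * Δ then Real.exp (-(b * Δ)) else 0) -
      (if d ≤ Δ / 4 then Real.exp (-(b * (Δ / 2))) else 0)) := by
  have hΔ : 0 ≤ Δ := by linarith
  have he : Real.exp (-(2 * b * p)) ≤ 1 := Real.exp_le_one_iff.2 (by nlinarith)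
  by_cases h₁ : d ≤ Δ / 4
  · rw [if_pos h₁, if_pos (by linarith), max_eq_left (by linarith), max_eq_left (by linarith),
      max_eq_left (by linarith), max_eq_left (by linarith)]
    exact le_of_eq (by ring)
  rw [if_neg h₁]
  by_cases h₂ : d ≤ 2 * Δ
  · rw [if_pos h₂, mul_sub, ← Real.exp_add, ← Real.exp_add]
    have h₃ : Real.exp (-(2 * b * p) + -(b * max (Δ / 2) (d - p)))
        ≤ Real.exp (-(b * max (Δ / 2) (d + p))) := by
      refine Real.exp_le_exp.2 ?_
      have : max (Δ / 2) (d + p) ≤ max (Δ / 2) (d - p) + 2 * p :=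
        max_le (by linarith [le_max_left (Δ / 2) (d - p)])
          (by linarith [le_max_right (Δ / 2) (d - p)])
      nlinarith
    have h₄ : Real.exp (-(b * max Δ (d + p))) - Real.exp (-(2 * b * p) + -(b * max Δ (d - p)))
        ≤ (1 - Real.exp (-(2 * b * p))) * Real.exp (-(b * Δ)) := by
      rcases le_total Δ (d - p) with h | h
      · rw [max_eq_right h, max_eq_right (by linarith)]
        have : -(2 * b * p) + -(b * (d - p)) = -(b * (d + p)) := by ring
        rw [this, sub_self]
        exact mul_nonneg (by linarith) (Real.exp_pos _).le
      · rw [max_eq_left h, Real.exp_add]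
        have : Real.exp (-(b * max Δ (d + p))) ≤ Real.exp (-(b * Δ)) :=
          Real.exp_le_exp.2 (by nlinarith [le_max_left Δ (d + p)])
        nlinarith
    linarith
  · rw [if_neg h₂, max_eq_right (by linarith), max_eq_right (by linarith),
      max_eq_right (by linarith), max_eq_right (by linarith)]
    simp

/-- Region growing. If the weighted mass near a centre is a `K`-th of the mass in its vicinity,
then some ball around the centre contains, with their pads, elements whose mass is at least the
discounted mass of all elements whose pads the ball touches. The radius is found by averaging
against the exponential density of rate `b`. -/
theorem exists_radius {ι : Type*} (A : Finset ι) (w d p : ι → ℝ) {b Δ K : ℝ}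
    (hb : 0 < b) (hΔ : 0 < Δ) (hw : ∀ e, 0 ≤ w e) (hp : ∀ e, 0 ≤ p e) (hp' : ∀ e, p e ≤ Δ / 4)
    (hK : K ≤ Real.exp (b * (Δ / 2)))
    (hmass : ∑ e ∈ A with d e ≤ 2 * Δ, w e * (1 - Real.exp (-(2 * b * p e))) ≤
      K * ∑ e ∈ A with d e ≤ Δ / 4, w e * (1 - Real.exp (-(2 * b * p e)))) :
    ∃ ρ, Δ / 2 ≤ ρ ∧ ρ ≤ Δ ∧
      ∑ e ∈ A with d e - p e ≤ ρ, w e * Real.exp (-(2 * b * p e)) ≤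
        ∑ e ∈ A with d e + p e ≤ ρ, w e := by
  by_contra! hcon
  have hint : ∀ c, IntervalIntegrable
      (fun ρ => if c ≤ ρ then b * Real.exp (-(b * ρ)) else 0) volume (Δ / 2) Δ :=
    fun c => intervalIntegrable_tail b c _ _
  let F : ℝ → ℝ := fun ρ => ∑ e ∈ A, w e * (Real.exp (-(2 * b * p e)) *
      (if d e - p e ≤ ρ then b * Real.exp (-(b * ρ)) else 0) -
      (if d e + p e ≤ ρ then b * Real.exp (-(b * ρ)) else 0))
  have hFint : ∀ e ∈ A, IntervalIntegrable (fun ρ => w e * (Real.exp (-(2 * b * p e)) *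
      (if d e - p e ≤ ρ then b * Real.exp (-(b * ρ)) else 0) -
      (if d e + p e ≤ ρ then b * Real.exp (-(b * ρ)) else 0))) volume (Δ / 2) Δ :=
    fun e _ => (((hint _).const_mul _).sub (hint _)).const_mul _
  have hpos : 0 < ∫ ρ in (Δ / 2)..Δ, F ρ := by
    refine intervalIntegral_pos_of_pos_on ?_ (fun ρ hρ => ?_) (by linarith)
    · have := IntervalIntegrable.sum A hFint
      rwa [Finset.sum_fn] at this
    · have h := hcon ρ hρ.1.le hρ.2.le
      have h₁ : F ρ = b * Real.exp (-(b * ρ)) *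
          (∑ e ∈ A with d e - p e ≤ ρ, w e * Real.exp (-(2 * b * p e)) -
            ∑ e ∈ A with d e + p e ≤ ρ, w e) := by
        simp only [F, Finset.sum_filter]
        rw [← Finset.sum_sub_distrib, Finset.mul_sum]
        refine Finset.sum_congr rfl fun e _ => ?_
        split_ifs <;> ring
      rw [h₁]
      exact mul_pos (mul_pos hb (Real.exp_pos _)) (sub_pos.2 h)
  have hval : ∫ ρ in (Δ / 2)..Δ, F ρ = ∑ e ∈ A, w e * (Real.exp (-(2 * b * p e)) *
        (Real.exp (-(b * max (Δ / 2) (d e - p e))) - Real.exp (-(b * max Δ (d e - p e)))) -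
      (Real.exp (-(b * max (Δ / 2) (d e + p e))) - Real.exp (-(b * max Δ (d e + p e))))) := by
    rw [integral_finsetSum hFint]
    refine Finset.sum_congr rfl fun e _ => ?_
    rw [intervalIntegral.integral_const_mul, integral_sub ((hint _).const_mul _) (hint _),
      intervalIntegral.integral_const_mul,
      integral_tail b _ (by linarith), integral_tail b _ (by linarith)]
  have hle : ∫ ρ in (Δ / 2)..Δ, F ρ ≤
      Real.exp (-(b * Δ)) * ∑ e ∈ A with d e ≤ 2 * Δ, w e * (1 - Real.exp (-(2 * b * p e))) -
      Real.exp (-(b * (Δ / 2))) *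
        ∑ e ∈ A with d e ≤ Δ / 4, w e * (1 - Real.exp (-(2 * b * p e))) := by
    rw [hval, Finset.sum_filter, Finset.sum_filter, Finset.mul_sum, Finset.mul_sum,
      ← Finset.sum_sub_distrib]
    refine Finset.sum_le_sum fun e _ => ?_
    refine (mul_le_mul_of_nonneg_left (tail_sub_tail_le hb.le (hp e) (hp' e)) (hw e)).trans
      (le_of_eq ?_)
    split_ifs <;> ring
  have hM : 0 ≤ ∑ e ∈ A with d e ≤ Δ / 4, w e * (1 - Real.exp (-(2 * b * p e))) :=
    Finset.sum_nonneg fun e _ => mul_nonneg (hw e) (sub_nonneg.2 (Real.exp_le_one_iff.2 (by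
      have := mul_nonneg hb.le (hp e)
      nlinarith)))
  have hfin : Real.exp (-(b * Δ)) *
      ∑ e ∈ A with d e ≤ 2 * Δ, w e * (1 - Real.exp (-(2 * b * p e))) ≤
      Real.exp (-(b * (Δ / 2))) *
        ∑ e ∈ A with d e ≤ Δ / 4, w e * (1 - Real.exp (-(2 * b * p e))) := by
    have h₁ : Real.exp (-(b * (Δ / 2))) = Real.exp (-(b * Δ)) * Real.exp (b * (Δ / 2)) := by
      rw [← Real.exp_add]; congr 1; ring
    rw [h₁, mul_assoc]
    exact mul_le_mul_of_nonneg_left (hmass.trans (mul_le_mul_of_nonneg_right hK hM))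
      (Real.exp_pos _).le
  linarith

end Radius

/-! ### Bounded partitions that pad a large local mass -/

section Carve

variable {X : Type u} [MetricSpace X] {n : ℕ}

/-- The map `g` is constant on the closed ball of radius `r` around `x`, that is, this ball is
contained in one part of the partition into fibres of `g`. -/
def IsPadded (g : X → X) (x : X) (r : ℝ) : Prop := ∀ y, dist y x ≤ r → g y = g x

/-- Among the positions of a finite family of weighted elements there is one around which the mass
is a large fraction of the mass in its vicinity. -/
theorem IsDoublingWith.exists_heavy_center (h : IsDoublingWith X n) {ι : Type*} {A : Finset ι}
    (hA : A.Nonempty) (pos : ι → X) {w : ι → ℝ} (hw : ∀ e, 0 ≤ w e) {Δ : ℝ} (hΔ : 0 < Δ) :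
    ∃ e₀ ∈ A, ∑ e ∈ A with dist (pos e) (pos e₀) ≤ 2 * Δ, w e ≤
      (n : ℝ) ^ 4 * ∑ e ∈ A with dist (pos e) (pos e₀) ≤ Δ / 4, w e := by
  classical
  obtain ⟨e₀, he₀, hmax⟩ := Finset.exists_max_image A
    (fun e' => ∑ e ∈ A with dist (pos e) (pos e') ≤ Δ / 4, w e) hA
  refine ⟨e₀, he₀, ?_⟩
  obtain ⟨S, hS, hcov⟩ := h.exists_cover 4 (pos e₀) (r := Δ / 8) (by positivity)
  have hM : 0 ≤ ∑ e ∈ A with dist (pos e) (pos e₀) ≤ Δ / 4, w e :=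
    Finset.sum_nonneg fun e _ => hw e
  have hball : ∀ y ∈ S, ∑ e ∈ A with dist (pos e) y ≤ Δ / 8, w e ≤
      ∑ e ∈ A with dist (pos e) (pos e₀) ≤ Δ / 4, w e := by
    intro y _
    rcases (A.filter fun e => dist (pos e) y ≤ Δ / 8).eq_empty_or_nonempty with he | ⟨e', he'⟩
    · rw [he, Finset.sum_empty]; exact hM
    · rw [Finset.mem_filter] at he'
      refine le_trans (Finset.sum_le_sum_of_subset_of_nonneg (fun e he => ?_) fun e _ _ => hw e)
        (hmax e' he'.1)
      rw [Finset.mem_filter] at he ⊢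
      exact ⟨he.1, by linarith [dist_triangle_right (pos e) (pos e') y, he.2, he'.2]⟩
  calc ∑ e ∈ A with dist (pos e) (pos e₀) ≤ 2 * Δ, w e
      ≤ ∑ y ∈ S, ∑ e ∈ A with dist (pos e) y ≤ Δ / 8, w e := by
        simp only [Finset.sum_filter]
        rw [Finset.sum_comm]
        refine Finset.sum_le_sum fun e _ => ?_
        have hnonneg : ∀ y ∈ S, 0 ≤ if dist (pos e) y ≤ Δ / 8 then w e else 0 := fun y _ => by
          split_ifs
          exacts [hw e, le_rfl]
        split_ifs with he
        · obtain ⟨y, hy, hey⟩ := Set.mem_iUnion₂.1 (hcov (Metric.mem_closedBall.2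
            (by linarith : dist (pos e) (pos e₀) ≤ 2 ^ 4 * (Δ / 8))))
          refine le_trans (le_of_eq ?_) (Finset.single_le_sum hnonneg hy)
          rw [if_pos (Metric.mem_closedBall.1 hey)]
        · exact Finset.sum_nonneg hnonneg
    _ ≤ S.card • ∑ e ∈ A with dist (pos e) (pos e₀) ≤ Δ / 4, w e :=
        Finset.sum_le_card_nsmul _ _ _ hball
    _ ≤ _ := by
        rw [nsmul_eq_mul]
        exact mul_le_mul_of_nonneg_right (by exact_mod_cast hS) hM

open Classical in
/-- Every finite family of weighted elements with pads admits a partition of bounded diameter such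
that, locally around every point, the mass of the elements whose pads are not cut is at least
the total mass, discounted exponentially in the pads. The parts are carved out one by one as
balls around heavy centres; an element is charged to the first ball that touches its pad. -/
theorem IsDoublingWith.exists_carving (h : IsDoublingWith X n) {ι : Type*} (A : Finset ι)
    (pos : ι → X) (w p : ι → ℝ) {b Δ : ℝ} (hb : 0 < b) (hΔ : 0 < Δ) (hw : ∀ e, 0 ≤ w e)
    (hp : ∀ e, 0 ≤ p e) (hp' : ∀ e, p e ≤ Δ / 4) (hn : (n : ℝ) ^ 4 ≤ Real.exp (b * (Δ / 2))) :
    ∃ g : X → X, (∀ x, dist x (g x) ≤ Δ) ∧ ∀ z ρ,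
      ∑ e ∈ A with dist (pos e) z ≤ ρ, w e * Real.exp (-(2 * b * p e)) ≤
        ∑ e ∈ A with dist (pos e) z ≤ ρ + 4 * Δ ∧ IsPadded g (pos e) (p e), w e := by
  induction A using Finset.strongInduction with
  | _ A ih =>
  rcases A.eq_empty_or_nonempty with rfl | hA
  · exact ⟨id, fun x => by simp [hΔ.le], fun z ρ => by simp⟩
  obtain ⟨e₀, he₀, hmass⟩ := h.exists_heavy_center hA pos
    (w := fun e => w e * (1 - Real.exp (-(2 * b * p e))))
    (fun e => mul_nonneg (hw e) (sub_nonneg.2 (Real.exp_le_one_iff.2 (by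
      have := mul_nonneg hb.le (hp e)
      nlinarith)))) hΔ
  obtain ⟨r, hr₁, hr₂, hr⟩ := exists_radius A w (fun e => dist (pos e) (pos e₀)) p hb hΔ hw hp hp'
    hn hmass
  set v := pos e₀ with hv
  set A' := A.filter fun e => ¬ dist (pos e) v - p e ≤ r with hA'
  have hsub : A' ⊂ A := by
    refine Finset.filter_ssubset.2 ⟨e₀, he₀, ?_⟩
    rw [not_not, ← hv, dist_self]
    linarith [hp e₀]
  obtain ⟨g, hg, hsum⟩ := ih A' hsub
  refine ⟨fun x => if dist x v ≤ r then v else g x, fun x => ?_, fun z ρ => ?_⟩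
  · dsimp only
    split_ifs with hx
    · exact hx.trans hr₂
    · exact hg x
  -- Pads that the ball does not touch keep their status, pads inside the ball are not cut.
  have hout : ∀ e ∈ A', IsPadded g (pos e) (p e) →
      IsPadded (fun x => if dist x v ≤ r then v else g x) (pos e) (p e) := by
    intro e he hpad y hy
    rw [hA', Finset.mem_filter, not_le] at he
    have h₁ : ¬ dist (pos e) v ≤ r := by linarith [hp e]
    have h₂ : ¬ dist y v ≤ r := by
      have := dist_triangle_left (pos e) v y
      linarith
    simp only [h₁, h₂, if_false]
    exact hpad y hy
  have hin : ∀ e, dist (pos e) v + p e ≤ r →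
      IsPadded (fun x => if dist x v ≤ r then v else g x) (pos e) (p e) := by
    intro e he y hy
    have h₁ : dist (pos e) v ≤ r := by linarith [hp e]
    have h₂ : dist y v ≤ r := by
      have := dist_triangle y (pos e) v
      linarith
    simp only [h₁, h₂, if_true]
  have hsplit : ∑ e ∈ A with dist (pos e) z ≤ ρ, w e * Real.exp (-(2 * b * p e)) =
      ∑ e ∈ A with dist (pos e) z ≤ ρ ∧ dist (pos e) v - p e ≤ r,
        w e * Real.exp (-(2 * b * p e)) +
      ∑ e ∈ A' with dist (pos e) z ≤ ρ, w e * Real.exp (-(2 * b * p e)) := by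
    rw [← Finset.sum_filter_add_sum_filter_not (A.filter fun e => dist (pos e) z ≤ ρ)
      (fun e => dist (pos e) v - p e ≤ r), Finset.filter_filter, Finset.filter_comm]
  have hball : ∑ e ∈ A with dist (pos e) z ≤ ρ ∧ dist (pos e) v - p e ≤ r,
      w e * Real.exp (-(2 * b * p e)) ≤
      ∑ e ∈ A with dist (pos e) z ≤ ρ + 4 * Δ ∧ dist (pos e) v + p e ≤ r, w e := by
    rcases (A.filter fun e => dist (pos e) z ≤ ρ ∧ dist (pos e) v - p e ≤ r).eq_empty_or_nonempty
      with he | ⟨e', he'⟩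
    · rw [he, Finset.sum_empty]
      exact Finset.sum_nonneg fun e _ => hw e
    · rw [Finset.mem_filter] at he'
      have hall : ∀ e, dist (pos e) v + p e ≤ r → dist (pos e) z ≤ ρ + 4 * Δ := by
        intro e he
        have h₁ := dist_triangle (pos e) v z
        have h₂ := dist_triangle_left v z (pos e')
        linarith [hp e, hp' e', he'.2.1, he'.2.2]
      calc _ ≤ ∑ e ∈ A with dist (pos e) v - p e ≤ r, w e * Real.exp (-(2 * b * p e)) := by
            refine Finset.sum_le_sum_of_subset_of_nonneg (fun e he => ?_)
              fun e _ _ => mul_nonneg (hw e) (Real.exp_pos _).le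
            rw [Finset.mem_filter] at he ⊢
            exact ⟨he.1, he.2.2⟩
        _ ≤ ∑ e ∈ A with dist (pos e) v + p e ≤ r, w e := hr
        _ ≤ _ := by
            refine Finset.sum_le_sum_of_subset_of_nonneg (fun e he => ?_) fun e _ _ => hw e
            rw [Finset.mem_filter] at he ⊢
            exact ⟨he.1, hall e he.2, he.2⟩
  rw [hsplit]
  refine (add_le_add hball (hsum z ρ)).trans ?_
  rw [← Finset.sum_union]
  · refine Finset.sum_le_sum_of_subset_of_nonneg (fun e he => ?_) fun e _ _ => hw e
    rw [Finset.mem_union, Finset.mem_filter, Finset.mem_filter] at he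
    rw [Finset.mem_filter]
    rcases he with he | he
    · exact ⟨he.1, he.2.1, hin e he.2.2⟩
    · exact ⟨hsub.1 he.1, he.2.1, hout e he.1 he.2.2⟩
  · refine Finset.disjoint_left.2 fun e he he' => ?_
    rw [Finset.mem_filter] at he he'
    have := (Finset.mem_filter.1 he'.1).2
    exact this (by linarith [hp e, he.2.2])

end Carve

/-! ### Several scales at once -/

section Scales

variable {X : Type u} [MetricSpace X] {n : ℕ}

open Classical in
/-- One carving per scale. Elements that are cut at some scale are dropped, and the discounts of
the later scales are put into the weights, so that the local mass bounds compose. -/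
theorem IsDoublingWith.exists_carvings (h : IsDoublingWith X n) {ι : Type*} (A : Finset ι)
    (pos : ι → X) (p : ℕ → ι → ℝ) (b Δ : ℕ → ℝ) (hb : ∀ j, 0 < b j) (hΔ : ∀ j, 0 < Δ j)
    (hp : ∀ j e, 0 ≤ p j e) (hp' : ∀ j e, p j e ≤ Δ j / 4)
    (hn : ∀ j, (n : ℝ) ^ 4 ≤ Real.exp (b j * (Δ j / 2))) (k : ℕ) (w : ι → ℝ)
    (hw : ∀ e, 0 ≤ w e) :
    ∃ g : ℕ → X → X, (∀ j x, dist x (g j x) ≤ Δ j) ∧ ∀ z ρ,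
      ∑ e ∈ A with dist (pos e) z ≤ ρ,
          w e * Real.exp (-∑ j ∈ Finset.range k, 2 * b j * p j e) ≤
        ∑ e ∈ A with dist (pos e) z ≤ ρ + ∑ j ∈ Finset.range k, 4 * Δ j ∧
          ∀ j < k, IsPadded (g j) (pos e) (p j e), w e := by
  induction k generalizing w with
  | zero => exact ⟨fun _ => id, fun j x => by simp [(hΔ j).le], fun z ρ => by simp⟩
  | succ k ih =>
    obtain ⟨g, hg, hsum⟩ := ih (fun e => w e * Real.exp (-(2 * b k * p k e)))
      fun e => mul_nonneg (hw e) (Real.exp_pos _).le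
    obtain ⟨g', hg', hsum'⟩ := h.exists_carving
      (A.filter fun e => ∀ j < k, IsPadded (g j) (pos e) (p j e)) pos w (p k) (hb k) (hΔ k) hw
      (hp k) (hp' k) (hn k)
    refine ⟨fun j => if j = k then g' else g j, fun j x => ?_, fun z ρ => ?_⟩
    · dsimp only
      split_ifs with hj
      · exact hj ▸ hg' x
      · exact hg j x
    · have h₁ := hsum z ρ
      have h₂ := hsum' z (ρ + ∑ j ∈ Finset.range k, 4 * Δ j)
      rw [Finset.filter_filter, Finset.filter_filter] at h₂
      refine le_trans (le_of_eq ?_) (h₁.trans (le_trans (le_of_eq ?_) (h₂.trans ?_)))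
      · refine Finset.sum_congr rfl fun e _ => ?_
        rw [Finset.sum_range_succ, neg_add, Real.exp_add]
        ring
      · exact Finset.sum_congr (Finset.filter_congr fun e _ => and_comm) fun _ _ => rfl
      · refine Finset.sum_le_sum_of_subset_of_nonneg (fun e he => ?_) fun e _ _ => hw e
        rw [Finset.mem_filter] at he ⊢
        obtain ⟨heA, hpad, hdist, hpad'⟩ := he
        refine ⟨heA, by rw [Finset.sum_range_succ]; linarith, fun j hj => ?_⟩
        dsimp only
        split_ifs with hjk
        · exact hjk ▸ hpad'
        · exact hpad j (by omega)

open Classical in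
/-- Repeating a step that settles, locally, a fraction `q` of the remaining elements. Since a step
only moves mass by a distance `c`, an element that is still unsettled after `m` steps had at least
`(1 + q) ^ m` elements within distance `m * c` at the beginning. -/
theorem exists_phases {ι G : Type*} (pos : ι → X) (S : G → ι → Prop) {q c : ℝ} (hq : 0 ≤ q)
    (hc : 0 ≤ c)
    (hstep : ∀ A : Finset ι, ∃ g : G, ∀ z ρ,
      q * ((A.filter fun e => dist (pos e) z ≤ ρ).card : ℝ) ≤
        ((A.filter fun e => dist (pos e) z ≤ ρ + c ∧ S g e).card : ℝ))
    (m : ℕ) (A : Finset ι) :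
    ∃ g : ℕ → G, ∀ e ∈ A, (∀ s < m, ¬ S (g s) e) →
      (1 + q) ^ m ≤ ((A.filter fun e' => dist (pos e') (pos e) ≤ m * c).card : ℝ) := by
  induction m generalizing A with
  | zero =>
    obtain ⟨g, -⟩ := hstep ∅
    refine ⟨fun _ => g, fun e he _ => ?_⟩
    have : 0 < (A.filter fun e' => dist (pos e') (pos e) ≤ (0 : ℕ) * c).card :=
      Finset.card_pos.2 ⟨e, Finset.mem_filter.2 ⟨he, by simp⟩⟩
    rw [pow_zero]
    exact_mod_cast this
  | succ m ih =>
    obtain ⟨g₀, hg₀⟩ := hstep A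
    obtain ⟨g, hg⟩ := ih (A.filter fun e => ¬ S g₀ e)
    refine ⟨fun s => Nat.casesOn s g₀ g, fun e he hS => ?_⟩
    have h₁ := hg e (Finset.mem_filter.2 ⟨he, hS 0 (Nat.succ_pos m)⟩)
      fun s hs => hS (s + 1) (Nat.succ_lt_succ hs)
    have h₂ := hg₀ (pos e) (m * c)
    rw [Finset.filter_filter] at h₁
    have h₃ : (A.filter fun e' => ¬ S g₀ e' ∧ dist (pos e') (pos e) ≤ m * c).card ≤
        (A.filter fun e' => dist (pos e') (pos e) ≤ m * c).card :=
      Finset.card_le_card (Finset.monotone_filter_right _ fun _ _ h => h.2)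
    have h₄ : (A.filter fun e' => ¬ S g₀ e' ∧ dist (pos e') (pos e) ≤ m * c).card +
        (A.filter fun e' => dist (pos e') (pos e) ≤ m * c + c ∧ S g₀ e').card ≤
        (A.filter fun e' => dist (pos e') (pos e) ≤ (m + 1 : ℕ) * c).card := by
      rw [← Finset.card_union_of_disjoint]
      · refine Finset.card_le_card fun x hx => ?_
        rw [Finset.mem_union, Finset.mem_filter, Finset.mem_filter] at hx
        rw [Finset.mem_filter]
        push_cast
        rcases hx with hx | hx
        · exact ⟨hx.1, by linarith [hx.2.2]⟩
        · exact ⟨hx.1, by linarith [hx.2.1]⟩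
      · refine Finset.disjoint_left.2 fun x hx hx' => ?_
        rw [Finset.mem_filter] at hx hx'
        exact hx.2.1 hx'.2.2
    have h₅ : (1 + q) ^ m ≤ ((A.filter fun e' => dist (pos e') (pos e) ≤ m * c).card : ℝ) :=
      h₁.trans (by exact_mod_cast h₃)
    calc (1 + q) ^ (m + 1) = (1 + q) ^ m + q * (1 + q) ^ m := by ring
      _ ≤ _ + _ := add_le_add h₁ ((mul_le_mul_of_nonneg_left h₅ hq).trans h₂)
      _ ≤ _ := by exact_mod_cast h₄

theorem sum_range_two_pow_le (L : ℕ) : ∑ j ∈ Finset.range L, (2 : ℝ) ^ j ≤ 2 ^ L := by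
  induction L with
  | zero => simp
  | succ L ih => rw [Finset.sum_range_succ, pow_succ]; linarith

theorem sum_range_two_pow_div_le (i L : ℕ) :
    ∑ j ∈ Finset.range L, (if i ≤ j then (2 : ℝ) ^ i / 2 ^ j else 0) ≤ 2 := by
  have h : ∀ L, (L ≤ i → ∑ j ∈ Finset.range L, (if i ≤ j then (2 : ℝ) ^ i / 2 ^ j else 0) = 0) ∧
      (i ≤ L → ∑ j ∈ Finset.range L, (if i ≤ j then (2 : ℝ) ^ i / 2 ^ j else 0)
        = 2 - 2 * (2 ^ i / 2 ^ L)) := by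
    intro L
    induction L with
    | zero =>
      refine ⟨fun _ => by simp, fun h => ?_⟩
      obtain rfl : i = 0 := by omega
      simp
    | succ L ih =>
      refine ⟨fun h => ?_, fun h => ?_⟩
      · rw [Finset.sum_range_succ, ih.1 (by omega), if_neg (by omega), add_zero]
      · rcases Nat.lt_or_ge L i with hlt | hge
        · obtain rfl : i = L + 1 := by omega
          rw [Finset.sum_range_succ, ih.1 (by omega), if_neg (by omega)]
          have : (2 : ℝ) ^ (L + 1) ≠ 0 := by positivity
          field_simp
          norm_num
        · rw [Finset.sum_range_succ, ih.2 hge, if_pos hge, pow_succ]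
          have : (2 : ℝ) ^ L ≠ 0 := by positivity
          field_simp
          ring
  rcases le_total L i with hL | hL
  · rw [(h L).1 hL]; norm_num
  · rw [(h L).2 hL]
    have : (0 : ℝ) ≤ 2 ^ i / 2 ^ L := by positivity
    linarith

/-- The partitions for `L` consecutive scales. There are `m` sequences of partitions, one
partition for each scale `2 ^ j * (a * r)`, `j < L`, such that the ball of radius `2 ^ i * r`
around any point is cut at no scale `j ≥ i` in at least one of the sequences. -/
theorem IsDoublingWith.exists_block [Finite X] (h : IsDoublingWith X n) (hn : 2 ≤ n) {r a : ℝ}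
    (hr : 0 < r) (ha : 8 ≤ a) {L m k : ℕ} (hk : 8 * m * 2 ^ L * a ≤ 2 ^ k)
    (hm : (L : ℝ) * n ^ k < (1 + Real.exp (-(64 * Real.log n / a))) ^ m) :
    ∃ g : ℕ → ℕ → X → X, (∀ s j x, dist x (g s j x) ≤ 2 ^ j * (a * r)) ∧
      ∀ x, ∀ i < L, ∃ s < m, ∀ j, i ≤ j → j < L → IsPadded (g s j) x (2 ^ i * r) := by
  classical
  have hn₀ : (0 : ℝ) < n := by positivity
  have hlog : 0 < Real.log n := Real.log_pos (by exact_mod_cast hn)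
  have ha₀ : 0 < a := by linarith
  let Δ : ℕ → ℝ := fun j => 2 ^ j * (a * r)
  let b : ℕ → ℝ := fun j => 8 * Real.log n / Δ j
  -- The element `(x, i)` stands for a point of a net for radius `2 ^ i * r`, so that a pad of twice
  -- this radius serves all points near `x`. It plays no role at scales below `i`.
  let p : ℕ → X × ℕ → ℝ := fun j e => if e.2 ≤ j then 2 * (2 ^ e.2 * r) else 0
  have hΔ : ∀ j, 0 < Δ j := fun j => by positivity
  have hb : ∀ j, 0 < b j := fun j => div_pos (by positivity) (hΔ j)
  have hp : ∀ j e, 0 ≤ p j e := fun j e => by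
    change 0 ≤ if e.2 ≤ j then 2 * (2 ^ e.2 * r) else 0
    split_ifs
    · positivity
    · exact le_rfl
  have hp' : ∀ j e, p j e ≤ Δ j / 4 := fun j e => by
    change (if e.2 ≤ j then 2 * (2 ^ e.2 * r) else 0) ≤ Δ j / 4
    split_ifs with he
    · have h₁ : (2 : ℝ) ^ e.2 ≤ 2 ^ j := pow_le_pow_right₀ (by norm_num) he
      have h₂ : 8 * r ≤ a * r := mul_le_mul_of_nonneg_right ha hr.le
      have h₃ : (2 : ℝ) ^ e.2 * (8 * r) ≤ 2 ^ j * (a * r) :=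
        mul_le_mul h₁ h₂ (by positivity) (by positivity)
      change 2 * (2 ^ e.2 * r) ≤ 2 ^ j * (a * r) / 4
      linarith
    · exact (div_pos (hΔ j) (by norm_num)).le
  have hexp : ∀ j, (n : ℝ) ^ 4 ≤ Real.exp (b j * (Δ j / 2)) := fun j => by
    have : b j * (Δ j / 2) = (4 : ℕ) * Real.log n := by
      have := (hΔ j).ne'
      simp only [b]
      field_simp
      norm_num
    rw [this, Real.exp_nat_mul, Real.exp_log hn₀]
  -- The total discount of an element over all scales is a geometric sum.
  have hdisc : ∀ e : X × ℕ, ∑ j ∈ Finset.range L, 2 * b j * p j e ≤ 64 * Real.log n / a := by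
    intro e
    have h₁ : ∀ j, 2 * b j * p j e =
        32 * Real.log n / a * (if e.2 ≤ j then (2 : ℝ) ^ e.2 / 2 ^ j else 0) := by
      intro j
      simp only [b, p, Δ]
      split_ifs
      · field_simp
        norm_num
      · simp
    simp only [h₁]
    rw [← Finset.mul_sum]
    calc _ ≤ 32 * Real.log n / a * 2 :=
          mul_le_mul_of_nonneg_left (sum_range_two_pow_div_le _ _) (by positivity)
      _ = _ := by ring
  have hcsum : ∑ j ∈ Finset.range L, 4 * Δ j ≤ 4 * 2 ^ L * (a * r) := by
    rw [← Finset.mul_sum, ← Finset.sum_mul, mul_assoc]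
    exact mul_le_mul_of_nonneg_left (mul_le_mul_of_nonneg_right (sum_range_two_pow_le L)
      (by positivity)) (by norm_num)
  choose N hN₁ hN₂ using fun i : ℕ =>
    exists_net (X := X) (r := 2 ^ i * r) (by positivity)
  obtain ⟨S, hS⟩ : ∃ S : {g : ℕ → X → X // ∀ j x, dist x (g j x) ≤ Δ j} → X × ℕ → Prop,
      ∀ g e, S g e ↔ ∀ j < L, IsPadded (g.1 j) e.1 (p j e) := ⟨_, fun _ _ => Iff.rfl⟩
  obtain ⟨g, hg⟩ := exists_phases (Prod.fst : X × ℕ → X) S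
    (q := Real.exp (-(64 * Real.log n / a))) (c := 4 * 2 ^ L * (a * r)) (Real.exp_pos _).le
    (by positivity) (fun A => by
      obtain ⟨g, hg, hsum⟩ := h.exists_carvings A Prod.fst p b Δ hb hΔ hp hp' hexp L
        (fun _ => 1) fun _ => zero_le_one
      refine ⟨⟨g, hg⟩, fun z ρ => ?_⟩
      have h₁ := hsum z ρ
      rw [Finset.sum_const, nsmul_eq_mul, mul_one] at h₁
      calc _ = ∑ e ∈ A with dist e.1 z ≤ ρ, Real.exp (-(64 * Real.log n / a)) := by
            rw [Finset.sum_const, nsmul_eq_mul, mul_comm]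
        _ ≤ ∑ e ∈ A with dist e.1 z ≤ ρ,
              1 * Real.exp (-∑ j ∈ Finset.range L, 2 * b j * p j e) := by
            refine Finset.sum_le_sum fun e _ => ?_
            rw [one_mul]
            exact Real.exp_le_exp.2 (neg_le_neg (hdisc e))
        _ ≤ _ := h₁
        _ ≤ _ := by
            refine Nat.cast_le.2 (Finset.card_le_card fun e he => ?_)
            rw [Finset.mem_filter] at he ⊢
            exact ⟨he.1, by linarith [he.2.1], (hS _ _).2 he.2.2⟩)
    m ((Finset.range L).biUnion fun i => (N i).image fun x => (x, i))
  refine ⟨fun s => (g s).1, fun s => (g s).2, fun x i hi => ?_⟩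
  obtain ⟨y, hy, hxy⟩ := hN₂ i x
  by_contra! hcon
  refine absurd (hg (y, i) (Finset.mem_biUnion.2 ⟨i, Finset.mem_range.2 hi,
    Finset.mem_image.2 ⟨y, hy, rfl⟩⟩) fun s hs hpad => ?_) (not_le.2 (lt_of_le_of_lt ?_ hm))
  · obtain ⟨j, hij, hjL, hj⟩ := hcon s hs
    refine hj fun z hz => ?_
    have h₁ : IsPadded ((g s).1 j) y (2 * (2 ^ i * r)) := by
      have := (hS _ _).1 hpad j hjL
      simpa only [p, if_pos hij] using this
    rw [h₁ z (by linarith [dist_triangle z x y]), h₁ x (by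
      have : 0 ≤ 2 ^ i * r := by positivity
      linarith)]
  · -- By packing, each of the `L` nets has at most `n ^ k` points in the ball.
    have hnet : ∀ i, (((N i).filter fun y' => dist y' y ≤ m * (4 * 2 ^ L * (a * r))).card) ≤
        n ^ k := by
      intro i
      refine h.card_le_of_separated k y (r := 2 ^ i * r / 2) (by positivity) _
        (fun u hu v hv huv => ?_) fun u hu => ?_
      · have := hN₁ i u (Finset.mem_filter.1 hu).1 v (Finset.mem_filter.1 hv).1 huv
        linarith
      · refine (Finset.mem_filter.1 hu).2.trans ?_
        have h₁ : (1 : ℝ) ≤ 2 ^ i := one_le_pow₀ (by norm_num)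
        have h₂ : 8 * m * 2 ^ L * a * (r / 2) ≤ 2 ^ k * (2 ^ i * r / 2) := by
          refine mul_le_mul hk ?_ (by positivity) (by positivity)
          nlinarith
        linarith
    have hle : (((Finset.range L).biUnion fun i => (N i).image fun x => (x, i)).filter
        fun e' => dist e'.1 (y, i).1 ≤ m * (4 * 2 ^ L * (a * r))).card ≤ L * n ^ k := by
      calc _ ≤ ((Finset.range L).biUnion fun i => ((N i).filter
              fun y' => dist y' y ≤ m * (4 * 2 ^ L * (a * r))).image fun x => (x, i)).card := by
            refine Finset.card_le_card fun e he => ?_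
            simp only [Finset.mem_filter, Finset.mem_biUnion, Finset.mem_image] at he ⊢
            obtain ⟨⟨j, hj, u, hu, rfl⟩, hd⟩ := he
            exact ⟨j, hj, u, ⟨hu, hd⟩, rfl⟩
        _ ≤ (Finset.range L).card * n ^ k := Finset.card_biUnion_le_card_mul _ _ _ fun i _ =>
            Finset.card_image_le.trans (hnet i)
        _ = L * n ^ k := by rw [Finset.card_range]
    exact_mod_cast hle

end Scales

/-! ### Joining the blocks of scales -/

section Join

variable {X : Type u} [MetricSpace X]

theorem exists_separation (X : Type u) [MetricSpace X] [Finite X] :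
    ∃ ε : ℝ, 0 < ε ∧ ∀ x y : X, x ≠ y → ε ≤ dist x y := by
  classical
  rcases isEmpty_or_nonempty X with hX | hX
  · exact ⟨1, one_pos, fun x => (hX.false x).elim⟩
  obtain ⟨p, hp⟩ := Finite.exists_min fun p : X × X => if p.1 = p.2 then 1 else dist p.1 p.2
  refine ⟨if p.1 = p.2 then 1 else dist p.1 p.2, ?_, fun x y hxy => ?_⟩
  · split_ifs with h
    · exact one_pos
    · exact dist_pos.2 h
  · simpa only [if_neg hxy] using hp (x, y)

/-- Given a sequence of partitions for each block, the partitions of all blocks are made to respect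
those of the lower blocks: before a partition of block `b` is applied, a point is moved to the
centre of its part in the last partition of block `b - 1`, and so on downwards. This is the map by
which points are moved. -/
def blockRep (G : ℕ → ℕ → X → X) (L : ℕ) : ℕ → X → X
  | 0 => id
  | b + 1 => G b (L - 1) ∘ blockRep G L b

theorem dist_blockRep_le {G : ℕ → ℕ → X → X} {L : ℕ} {a : ℝ} {r : ℕ → ℝ} (ha : 1 ≤ a)
    (hL : 2 * a ≤ 2 ^ L) (hr : ∀ b, 0 < r b) (hr' : ∀ b, r (b + 1) = 2 ^ (2 * L) * r b)
    (hG : ∀ b j x, dist x (G b j x) ≤ 2 ^ j * (a * r b)) (b : ℕ) (x : X) :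
    dist x (blockRep G L b x) ≤ r b / 2 := by
  induction b with
  | zero => simpa [blockRep] using (half_pos (hr 0)).le
  | succ b ih =>
    obtain ⟨l, rfl⟩ : ∃ l, L = l + 1 := by
      cases L with
      | zero => norm_num at hL; linarith
      | succ l => exact ⟨l, rfl⟩
    have h₁ := hG b l (blockRep G (l + 1) b x)
    have h₂ := dist_triangle x (blockRep G (l + 1) b x) (G b l (blockRep G (l + 1) b x))
    change dist x (G b l (blockRep G (l + 1) b x)) ≤ r (b + 1) / 2
    have h₃ : (1 : ℝ) ≤ 2 ^ l := one_le_pow₀ (by norm_num)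
    have h₄ : a ≤ 2 ^ l := by rw [pow_succ] at hL; linarith
    have h₅ : 2 ^ l * (a * r b) ≤ 2 ^ l * (2 ^ l * r b) := by
      have := (hr b).le
      gcongr
    have h₆ : r (b + 1) = 4 * (2 ^ l * (2 ^ l * r b)) := by rw [hr']; ring
    have h₇ : r b ≤ 2 ^ l * (2 ^ l * r b) := by
      have := mul_le_mul h₃ h₃ zero_le_one (by positivity)
      nlinarith [hr b]
    linarith [hr b]

/-- Blocks of `L` consecutive scales separated by gaps of `L` scales are joined to a single HST,
in which a pair of points that is padded in one block has small distance. -/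
theorem exists_hst_of_blocks [Finite X] [Nonempty X] {G : ℕ → ℕ → X → X} {L : ℕ} {a : ℝ}
    {r : ℕ → ℝ} (ha : 1 ≤ a) (hL : 2 * a ≤ 2 ^ L) (hr : ∀ b, 0 < r b)
    (hr' : ∀ b, r (b + 1) = 2 ^ (2 * L) * r b)
    (hG : ∀ b j x, dist x (G b j x) ≤ 2 ^ j * (a * r b)) (B : ℕ)
    (hB : ∀ x y : X, dist x y ≤ r B) :
    ∃ T : WeightedTree X, T.Dominating ∧ T.IsUltrametric ∧ T.IsHST 2 ∧
      ∀ b < B, ∀ i < L, ∀ x y, (∀ j, i ≤ j → j < L → IsPadded (G b j) x (2 ^ i * r b)) →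
        2 * dist x y ≤ 2 ^ i * r b → T.treeDist x y ≤ 4 * (2 ^ i * (a * r b)) := by
  have hL₀ : 0 < L := by
    rcases Nat.eq_zero_or_pos L with rfl | h
    · norm_num at hL; linarith
    · exact h
  have hrep := dist_blockRep_le ha hL hr hr' hG
  let h : ℕ → X → X := fun n => G (n / L) (n % L) ∘ blockRep G L (n / L)
  let s : ℕ → ℝ := fun n => 4 * (2 ^ (n % L) * (a * r (n / L)))
  have hsn : ∀ n, s n = 4 * (2 ^ (n % L) * (a * r (n / L))) := fun n => rfl
  have hr₀ : ∀ b, r b = 2 ^ (2 * L * b) * r 0 := by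
    intro b
    induction b with
    | zero => simp
    | succ b ih => rw [hr', ih, ← mul_assoc, ← pow_add]; congr 2; ring
  have hs : ∀ n, s n = 4 * (a * r 0) * 2 ^ (n + L * (n / L)) := by
    intro n
    have h₁ : n + L * (n / L) = n % L + 2 * L * (n / L) := by
      have := Nat.mod_add_div n L
      have : 2 * L * (n / L) = 2 * (L * (n / L)) := by ring
      omega
    rw [hsn, hr₀ (n / L), h₁, pow_add]
    ring
  have har : 0 < a * r 0 := mul_pos (by linarith) (hr 0)
  have hh : ∀ n x, dist x (h n x) ≤ s n / 2 := by
    intro n x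
    have h₁ := hrep (n / L) x
    have h₂ := hG (n / L) (n % L) (blockRep G L (n / L) x)
    have h₃ := dist_triangle x (blockRep G L (n / L) x) (h n x)
    have h₄ : (1 : ℝ) ≤ 2 ^ (n % L) := one_le_pow₀ (by norm_num)
    have h₅ : 1 * (1 * r (n / L)) ≤ 2 ^ (n % L) * (a * r (n / L)) := by
      have := (hr (n / L)).le
      gcongr
    rw [hsn]
    change dist _ (h n x) ≤ _ at h₂
    have := hr (n / L)
    linarith
  obtain ⟨T, hT₁, hT₂, hT₃, hT₄⟩ := exists_hst_of_partitions h (B * L) s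
    (by rw [hs]; positivity)
    (fun n => by
      rw [hs, hs, mul_left_comm, ← pow_succ']
      refine mul_le_mul_of_nonneg_left (pow_le_pow_right₀ (by norm_num) ?_) (by positivity)
      have : L * (n / L) ≤ L * ((n + 1) / L) :=
        Nat.mul_le_mul_left L (Nat.div_le_div_right (Nat.le_succ n))
      omega)
    (fun n _ x y hxy => by
      have h₁ := hh n x
      have h₂ := hh n y
      rw [← hxy] at h₂
      linarith [dist_triangle_right x y (h n x)])
    (fun x y => by
      rw [hsn, Nat.mul_mod_left, Nat.mul_div_cancel _ hL₀, pow_zero, one_mul]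
      have := hB x y
      have := hr B
      nlinarith)
  refine ⟨T, hT₁, hT₂, hT₃, fun b hb i hi x y hpad hxy => ?_⟩
  have hdiv : (b * L + i) / L = b := by
    rw [add_comm, Nat.add_mul_div_right _ _ hL₀, Nat.div_eq_of_lt hi, zero_add]
  have hmod : (b * L + i) % L = i := by
    rw [add_comm, Nat.add_mul_mod_self_right, Nat.mod_eq_of_lt hi]
  have hsame : ∀ j, i ≤ j → j < L → G b j (blockRep G L b x) = G b j (blockRep G L b y) := by
    intro j hij hj
    have h₁ : r b ≤ 2 ^ i * r b :=
      le_mul_of_one_le_left (hr b).le (one_le_pow₀ (by norm_num))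
    have hx := hrep b x
    have hy := hrep b y
    have := hr b
    rw [hpad j hij hj (blockRep G L b x) (by rw [dist_comm]; linarith),
      hpad j hij hj (blockRep G L b y) (by
        have := dist_triangle_left (blockRep G L b y) x y
        rw [dist_comm y x] at this
        linarith)]
  have hsame' : ∀ b', b + 1 ≤ b' → blockRep G L b' x = blockRep G L b' y := by
    intro b' hb'
    induction b', hb' using Nat.le_induction with
    | base => exact hsame (L - 1) (by omega) (by omega)
    | succ b' _ ih => exact congrArg (G b' (L - 1)) ih
  have hfin := hT₄ (b * L + i) (by
    have : (b + 1) * L ≤ B * L := Nat.mul_le_mul_right L hb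
    rw [add_mul] at this
    omega) x y fun k hk _ => by
      have hbk : b ≤ k / L := by
        have := Nat.div_le_div_right (c := L) hk
        rwa [hdiv] at this
      rcases hbk.eq_or_lt with he | hlt
      · change G (k / L) (k % L) (blockRep G L (k / L) x) =
          G (k / L) (k % L) (blockRep G L (k / L) y)
        rw [← he]
        refine hsame _ ?_ (Nat.mod_lt _ hL₀)
        have := Nat.mod_add_div k L
        rw [← he, mul_comm L b] at this
        omega
      · exact congrArg (G (k / L) (k % L)) (hsame' _ hlt)
  rwa [hsn, hdiv, hmod] at hfin

/-- If for every scale there are `m` sequences of partitions for the next `L` scales that pad all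
points, then `2 * m` HSTs cover all pairs: the blocks of even and of odd number are joined
separately, which leaves gaps of `L` scales between the blocks. -/
theorem exists_tree_cover_of_blocks [Finite X] [Nonempty X] {L m : ℕ} {a : ℝ}
    (ha : 1 ≤ a) (hL : 2 * a ≤ 2 ^ L)
    (hblock : ∀ r : ℝ, 0 < r → ∃ g : ℕ → ℕ → X → X,
      (∀ s j x, dist x (g s j x) ≤ 2 ^ j * (a * r)) ∧
      ∀ x, ∀ i < L, ∃ s < m, ∀ j, i ≤ j → j < L → IsPadded (g s j) x (2 ^ i * r)) :
    ∃ T : Fin (2 * m) → WeightedTree X, IsTreeCover (16 * a) (2 * m) T ∧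
      ∀ i, (T i).IsUltrametric ∧ (T i).IsHST 2 := by
  have hL₀ : 0 < L := by
    rcases Nat.eq_zero_or_pos L with rfl | h
    · norm_num at hL; linarith
    · exact h
  obtain ⟨ε, hε, hsep⟩ := exists_separation X
  obtain ⟨M, hM⟩ : ∃ M : ℝ, ∀ x y : X, dist x y ≤ M := by
    obtain ⟨p, hp⟩ := Finite.exists_max fun p : X × X => dist p.1 p.2
    exact ⟨_, fun x y => hp (x, y)⟩
  obtain ⟨B, hB⟩ : ∃ B : ℕ, 4 * M / ε < 2 ^ B := pow_unbounded_of_one_lt _ (by norm_num)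
  rw [div_lt_iff₀ hε] at hB
  choose! g hg₁ hg₂ using hblock
  let r : ℕ → ℕ → ℝ := fun θ b => 2 ^ (L * (2 * b + θ)) * ε
  have hr : ∀ θ b, 0 < r θ b := fun θ b => by positivity
  have htree : ∀ (θ : Fin 2) (s : Fin m), ∃ T : WeightedTree X,
      T.Dominating ∧ T.IsUltrametric ∧ T.IsHST 2 ∧
      ∀ b < B, ∀ i < L, ∀ x y, (∀ j, i ≤ j → j < L →
        IsPadded (g (r θ b) s j) x (2 ^ i * r θ b)) →
        2 * dist x y ≤ 2 ^ i * r θ b → T.treeDist x y ≤ 4 * (2 ^ i * (a * r θ b)) := by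
    intro θ s
    refine exists_hst_of_blocks (G := fun b => g (r θ b) s) (r := r θ) ha hL (hr θ)
      (fun b => ?_) (fun b => hg₁ _ (hr θ b) s) B fun x y => ?_
    · change 2 ^ (L * (2 * (b + 1) + θ)) * ε = 2 ^ (2 * L) * (2 ^ (L * (2 * b + θ)) * ε)
      rw [← mul_assoc, ← pow_add]
      congr 2
      ring
    · have h₁ : (2 : ℝ) ^ B * ε ≤ 2 ^ (L * (2 * B + θ)) * ε := by
        refine mul_le_mul_of_nonneg_right (pow_le_pow_right₀ (by norm_num) ?_) hε.le
        have : 1 * (2 * B + θ) ≤ L * (2 * B + θ) := Nat.mul_le_mul_right _ hL₀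
        omega
      have h₂ : 0 ≤ M := dist_nonneg.trans (hM x x)
      change dist x y ≤ 2 ^ (L * (2 * B + θ)) * ε
      linarith [hM x y]
  choose T hT₁ hT₂ hT₃ hT₄ using htree
  refine ⟨fun i => T (finProdFinEquiv.symm i).1 (finProdFinEquiv.symm i).2,
    ⟨fun i => hT₁ _ _, fun x y hxy => ?_⟩, fun i => ⟨hT₂ _ _, hT₃ _ _⟩⟩
  have hd := hsep x y hxy
  -- The scale `e` of the pair `x, y`, which is number `i` in block `e / L`.
  obtain ⟨e, he₁, he₂⟩ := exists_nat_pow_near (y := (2 : ℝ)) (x := 4 * dist x y / ε)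
    (by rw [le_div_iff₀ hε]; linarith) (by norm_num)
  rw [le_div_iff₀ hε] at he₁
  rw [div_lt_iff₀ hε, pow_succ] at he₂
  have hre : ∀ θ, θ = e / L % 2 → 2 ^ (e % L) * r θ (e / L / 2) = 2 ^ e * ε := by
    rintro θ rfl
    change 2 ^ (e % L) * (2 ^ (L * (2 * (e / L / 2) + e / L % 2)) * ε) = _
    rw [← mul_assoc, ← pow_add, Nat.div_add_mod, Nat.mod_add_div]
  have heB : e < B := by
    have : (2 : ℝ) ^ e < 2 ^ B := by
      by_contra! hcon
      have := mul_le_mul_of_nonneg_right hcon hε.le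
      linarith [hM x y]
    exact (pow_lt_pow_iff_right₀ (by norm_num)).1 this
  obtain ⟨s, hs, hpad⟩ := hg₂ (r (e / L % 2) (e / L / 2)) (hr _ _) x (e % L) (Nat.mod_lt _ hL₀)
  refine ⟨finProdFinEquiv (⟨e / L % 2, Nat.mod_lt _ two_pos⟩, ⟨s, hs⟩), ?_⟩
  simp only [Equiv.symm_apply_apply]
  have hb : e / L / 2 < B :=
    lt_of_le_of_lt ((Nat.div_le_self _ _).trans (Nat.div_le_self _ _)) heB
  refine (hT₄ ⟨e / L % 2, Nat.mod_lt _ two_pos⟩ ⟨s, hs⟩ (e / L / 2) hb (e % L)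
    (Nat.mod_lt _ hL₀) x y hpad ?_).trans ?_
  · rw [hre _ rfl]
    linarith
  · have h₁ : 2 ^ (e % L) * (a * r (e / L % 2) (e / L / 2)) = a * (2 ^ e * ε) := by
      rw [← hre _ rfl]; ring
    calc _ = 4 * (a * (2 ^ e * ε)) := by rw [← h₁]
      _ ≤ 4 * (a * (4 * dist x y)) := by gcongr
      _ = 16 * a * dist x y := by ring

end Join

/-! ### The choice of parameters -/

/-- The size of the cover. With `t = n ^ (1 / (4 * α))`, a phase settles the fraction `1 / t` of
the mass, and `m` is about `t ^ 4 * log n * log α`. The exponent `k` of the packing bound involves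
`log m`, hence `log t` and `log (log n)`, but both are bounded by multiples of `t * log α`. -/
theorem exists_parameters {n : ℕ} (hn : 2 ≤ n) {α : ℝ} (hα : 2 ≤ α) : ∃ L m k : ℕ,
    2 * (256 * α) ≤ 2 ^ L ∧ 8 * m * 2 ^ L * (256 * α) ≤ (2 : ℝ) ^ k ∧
      (L : ℝ) * n ^ k < (1 + Real.exp (-(64 * Real.log n / (256 * α)))) ^ m ∧
      (m : ℝ) ≤ 1024 * ((n : ℝ) ^ (1 / α) * Real.log α * Real.log n) := by
  have hn₀ : (0 : ℝ) < n := by positivity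
  have hn₂ : (2 : ℝ) ≤ n := by exact_mod_cast hn
  have hα₀ : 0 < α := by linarith
  have hl2 := Real.log_two_gt_d9
  have hl2' := Real.log_two_lt_d9
  obtain ⟨l, hl⟩ : ∃ l, l = Real.log n := ⟨_, rfl⟩
  obtain ⟨A, hA⟩ : ∃ A, A = Real.log α := ⟨_, rfl⟩
  have hlA : Real.log 2 ≤ A := hA ▸ Real.log_le_log two_pos hα
  have hll : Real.log 2 ≤ l := hl ▸ Real.log_le_log two_pos hn₂
  obtain ⟨τ, hτ⟩ : ∃ τ, τ = l / (4 * α) := ⟨_, rfl⟩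
  have hτ₀ : 0 < τ := hτ ▸ div_pos (by linarith) (by linarith)
  obtain ⟨t, ht⟩ : ∃ t, t = Real.exp τ := ⟨_, rfl⟩
  have hτt : τ + 1 ≤ t := ht ▸ Real.add_one_le_exp τ
  have ht₁ : 1 ≤ t := by linarith
  have hnt : (n : ℝ) ^ (1 / α) = t ^ 4 := by
    rw [Real.rpow_def_of_pos hn₀, ht, ← Real.exp_nat_mul, ← hl, hτ]
    congr 1
    field_simp
    norm_num
  have hq : Real.exp (-(64 * Real.log n / (256 * α))) = t⁻¹ := by
    rw [ht, ← Real.exp_neg, ← hl, hτ]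
    congr 2
    field_simp
    ring
  rw [hnt, hq, ← hl, ← hA]
  obtain ⟨M, hM⟩ : ∃ M, M = 512 * (t ^ 4 * A * l) := ⟨_, rfl⟩
  have ht4 : 1 ≤ t ^ 4 := one_le_pow₀ ht₁
  have hAl : 1 / 4 ≤ A * l := by nlinarith
  have hM₁ : 1 ≤ M := by
    have := mul_le_mul ht4 hAl (by norm_num) (by linarith)
    rw [hM]; linarith
  have hm₁ : M ≤ ⌈M⌉₊ := Nat.le_ceil M
  have hm₂ : (⌈M⌉₊ : ℝ) ≤ 2 * M := by
    have := Nat.ceil_lt_add_one (by linarith : 0 ≤ M)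
    linarith
  obtain ⟨L', hL₁, hL₂⟩ := exists_nat_pow_near (x := 2 * (256 * α)) (y := (2 : ℝ))
    (by linarith) (by norm_num)
  have hm₀ : (1 : ℝ) ≤ ⌈M⌉₊ := hM₁.trans hm₁
  have hL2 : (1 : ℝ) ≤ 2 ^ (L' + 1) := one_le_pow₀ (by norm_num)
  obtain ⟨k', hk₁, hk₂⟩ := exists_nat_pow_near (x := 8 * ⌈M⌉₊ * 2 ^ (L' + 1) * (256 * α))
    (y := (2 : ℝ)) (by
      have := mul_le_mul hm₀ hL2 zero_le_one (by linarith)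
      have := mul_le_mul this (by linarith : 1 ≤ 256 * α) zero_le_one (by positivity)
      linarith) (by norm_num)
  refine ⟨L' + 1, ⌈M⌉₊, k' + 1, hL₂.le, hk₂.le, ?_, by linarith [hm₂, hM]⟩
  have hlogt : Real.log t = τ := by rw [ht, Real.log_exp]
  have hlτ : l = 4 * α * τ := by rw [hτ]; field_simp
  have hAt : A ≤ t * A := le_mul_of_one_le_left (by linarith) ht₁
  have htA : t ≤ 2 * (t * A) := by nlinarith
  -- `log m ≤ log (2 * M)`, in terms of `t * A`
  have hlogA : Real.log A ≤ A := (Real.log_le_sub_one_of_pos (by linarith)).trans (by linarith)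
  have hlogl : Real.log l = 2 * Real.log 2 + A + Real.log τ := by
    rw [hlτ, Real.log_mul (by positivity) hτ₀.ne', Real.log_mul (by norm_num) hα₀.ne', hA,
      show (4 : ℝ) = 2 ^ 2 by norm_num, Real.log_pow]
    norm_num
  have hlogτ : Real.log τ ≤ t := (Real.log_le_sub_one_of_pos hτ₀).trans (by linarith)
  have hlogm : Real.log ⌈M⌉₊ ≤ 12 * Real.log 2 + 2 * A + 5 * t := by
    have h₁ : Real.log ⌈M⌉₊ ≤ Real.log (2 * M) :=
      Real.log_le_log (by linarith) hm₂
    have hA₀ : 0 < A := by linarith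
    have hl₀ : 0 < l := by linarith
    have h₂ : Real.log (2 * M) = 10 * Real.log 2 + (4 * τ + Real.log A + Real.log l) := by
      rw [hM, ← mul_assoc, show (2 * 512 : ℝ) = 2 ^ 10 by norm_num,
        Real.log_mul (by positivity) (by positivity), Real.log_mul (by positivity) hl₀.ne',
        Real.log_mul (by positivity) hA₀.ne', Real.log_pow, Real.log_pow, hlogt]
      norm_num
    linarith
  have hkl : k' * Real.log 2 ≤ 33 * Real.log 2 + 4 * A + 5 * t := by
    have h₁ : (2 : ℝ) ^ (L' + 1) ≤ 4 * (256 * α) := by rw [pow_succ]; linarith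
    have h₂ : (2 : ℝ) ^ k' ≤ 2 ^ 21 * α ^ 2 * ⌈M⌉₊ := by
      refine hk₁.trans ?_
      calc 8 * ⌈M⌉₊ * 2 ^ (L' + 1) * (256 * α)
          ≤ 8 * ⌈M⌉₊ * (4 * (256 * α)) * (256 * α) := by gcongr
        _ = 2 ^ 21 * α ^ 2 * ⌈M⌉₊ := by ring
    have h₃ := Real.log_le_log (by positivity) h₂
    rw [Real.log_pow, Real.log_mul (by positivity) (by positivity),
      Real.log_mul (by positivity) (by positivity), Real.log_pow, Real.log_pow, ← hA] at h₃
    push_cast at h₃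
    linarith
  have hk : ((k' + 1 : ℕ) : ℝ) ≤ 97 * (t * A) := by
    push_cast
    have : (k' : ℝ) * (1 / 2 : ℝ) ≤ k' * Real.log 2 :=
      mul_le_mul_of_nonneg_left (by linarith) (Nat.cast_nonneg _)
    linarith
  have hlogL : Real.log ((L' + 1 : ℕ) : ℝ) ≤ 24 * (t * A) := by
    have h₁ : ((L' + 1 : ℕ) : ℝ) ≤ 2 ^ 10 * α := by
      have h₂ : ((L' + 1 : ℕ) : ℝ) ≤ 2 ^ (L' + 1) := by exact_mod_cast Nat.lt_two_pow_self.le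
      rw [pow_succ] at h₂
      linarith
    have h₃ := Real.log_le_log (by positivity) h₁
    rw [Real.log_mul (by positivity) (by positivity), Real.log_pow, ← hA] at h₃
    push_cast at h₃ ⊢
    linarith
  have hlog1 : 1 / (2 * t) ≤ Real.log (1 + t⁻¹) := by
    have h₁ := Real.one_sub_inv_le_log_of_pos (by positivity : 0 < 1 + t⁻¹)
    refine le_trans ?_ h₁
    have h₂ : 1 - (1 + t⁻¹)⁻¹ = 1 / (t + 1) := by
      field_simp
      ring
    rw [h₂]
    exact one_div_le_one_div_of_le (by linarith) (by linarith)
  have hmlog : 256 * (t * A) * l ≤ ⌈M⌉₊ * Real.log (1 + t⁻¹) := by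
    have h₁ : 256 * (t ^ 3 * A * l) = M * (1 / (2 * t)) := by
      rw [hM]; field_simp; ring
    have h₂ : t * (A * l) ≤ t ^ 3 * (A * l) := by
      refine mul_le_mul_of_nonneg_right ?_ (by linarith)
      calc t = t ^ 1 := (pow_one t).symm
        _ ≤ t ^ 3 := pow_le_pow_right₀ ht₁ (by norm_num)
    calc 256 * (t * A) * l ≤ M * (1 / (2 * t)) := by rw [← h₁]; linarith
      _ ≤ ⌈M⌉₊ * Real.log (1 + t⁻¹) := mul_le_mul hm₁ hlog1 (by positivity) (by linarith)
  have hL₀ : (0 : ℝ) < (L' + 1 : ℕ) := by positivity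
  rw [← Real.log_lt_log_iff (by positivity) (by positivity),
    Real.log_mul hL₀.ne' (by positivity), Real.log_pow, Real.log_pow, ← hl]
  have hB : 1 / 2 ≤ t * A := by linarith
  have h₁ : ((k' + 1 : ℕ) : ℝ) * l ≤ 97 * (t * A) * l :=
    mul_le_mul_of_nonneg_right hk (by linarith)
  have h₂ : t * A * (1 / 2) ≤ t * A * l := mul_le_mul_of_nonneg_left (by linarith) (by linarith)
  have h₃ : 0 < t * A * l := mul_pos (by linarith) (by linarith)
  linarith

/-- Every finite metric space with doubling constant `lam` has, for every `α ≥ 2`, a tree cover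
with distortion `O(α)` and `O(lam ^ (1 / α) * log α * log lam)` trees, all of which are
ultrametrics (`2`-HSTs) on the points of the space. -/
theorem mainTheorem2 :
    ∃ C D : ℝ, 0 < C ∧ 0 < D ∧
      ∀ (X : Type u) [MetricSpace X] [Finite X] (lam : ℕ), lam = doublingConstant X →
        ∀ α : ℝ, 2 ≤ α →
          ∃ (k : ℕ) (T : Fin k → WeightedTree X),
            (k : ℝ) ≤ D * ((lam : ℝ) ^ (1 / α) * Real.log α * Real.log lam) ∧
            IsTreeCover (C * α) k T ∧
            ∀ i, (T i).IsUltrametric ∧ (T i).IsHST 2 := by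
  refine ⟨16 * 256, 2 * 1024, by norm_num, by norm_num, fun X _ _ lam hlam α hα => ?_⟩
  have hdoubling : IsDoublingWith X lam := hlam ▸ isDoublingWith_doublingConstant X
  rcases subsingleton_or_nontrivial X with hX | ⟨x, y, hxy⟩
  · refine ⟨0, Fin.elim0, ?_, ⟨fun i => i.elim0, fun x y h => absurd (Subsingleton.elim x y) h⟩,
      fun i => i.elim0⟩
    rw [Nat.cast_zero]
    have h₁ := Real.log_nonneg (by linarith : (1 : ℝ) ≤ α)
    have h₂ := Real.log_natCast_nonneg lam
    positivity
  · have hn : 2 ≤ lam := hdoubling.two_le hxy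
    have : Nonempty X := ⟨x⟩
    obtain ⟨L, m, k, hL, hk, hm, hsize⟩ := exists_parameters hn hα
    obtain ⟨T, hT, hT'⟩ := exists_tree_cover_of_blocks (X := X) (L := L) (m := m) (a := 256 * α)
      (by linarith) hL fun r hr => hdoubling.exists_block hn hr (by linarith) hk hm
    refine ⟨2 * m, T, ?_, by rwa [← mul_assoc] at hT, hT'⟩
    push_cast
    linarith
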